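/- **Theorem 4.1 (Probabilistic rounding error analysis of Shifted CholeskyQR).** For a real $m\times n$ matrix $A$ with columns $A_1,\dots,A_n$ let $\|A\|_2$ be the spectral norm, $\|A\|_F$ the Frobenius norm and $\|A\|_g=\max_{1\le j\le n}\|A_j\|_2$. Let $T\in\mathbb R^{m\times n}$ be nonzero, let $u>0$ be the unit roundoff and $\lambda>0$, and put $P(\lambda)=1-2\exp\!\big(-\tfrac{\lambda^2(1-u)^2}{2}\big)$, $Q(\lambda,k)=1-k(1-P(\lambda))$ and $p_1=\|T\|_g/\|T\|_2$. Assume $$\max(\lambda\sqrt m\,n u,\;mnu)\le\tfrac1{2200},\qquad \max(\lambda\sqrt{n+1}\,n u,\;n(n+1)u)\le\tfrac1{2200},$$ and that the three numbers $Q(\lambda,mn^2)$, $Q(\lambda,\tfrac{n^3}{6}+\tfrac{n^2}{2}+\tfrac n3)$, $Q(\lambda,\tfrac{n(n+1)}2)$ are positive. Let $s=11\lambda(\sqrt m\,nu+\sqrt{n+1}\,nu)\|T\|_g^2$ and let one step of Shifted CholeskyQR be carried out in floating-point arithmetic: form $U=T^\top T$ by inner products, add $s$ to the diagonal, compute the upper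 triangular Cholesky factor $V$ of $U+sI$ (from $v_{ii}=(a_{ii}-\sum_{k<i}v_{ki}^2)^{1/2}$ and $v_{ij}=(a_{ij}-\sum_{k<i}v_{ki}v_{kj})/v_{ii}$ for $i<j$, where $A=(a_{ij})$ is the computed $U+sI$), and compute $Q=TV^{-1}$ row by row by substitution; each sum may be evaluated in any fixed order (any parenthesisation). Every operation returns its exact result multiplied by $1+\delta$, where the $\delta$'s of the operations are independent random variables with mean zero and $|\delta|\le u$ (the Higham–Mary model). Then, with probability at least $$Q(\lambda,mn^2)\;Q\!\left(\lambda,\tfrac{n^3}{6}+\tfrac{n^2}{2}+\tfrac n3\right)Q\!\left(\lambda,\tfrac{n(n+1)}2\right),$$ the algorithm runs to completion (all pivots in the Cholesky factorization are positive) and the computed factors satisfy both $$\|Q^\top Q-I\|_2\le 1.6\qquad\text{and}\qquad \|QV-T\|_F\le 1.67\,\lambda\,p_1\,n\sqrt n\,u\,\|T\|_2 .$$ -/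

import Mathlib

open MeasureTheory ProbabilityTheory

noncomputable section

namespace SCholQR

/-! ### Matrix norms -/

/-- The spectral norm: the operator norm between Euclidean spaces. -/
def norm2 {m n : ℕ} (A : Matrix (Fin m) (Fin n) ℝ) : ℝ :=
  letI : NormedAddCommGroup (Matrix (Fin m) (Fin n) ℝ) := Matrix.instL2OpNormedAddCommGroup
  ‖A‖

/-- The Frobenius norm. -/
def normF {m n : ℕ} (A : Matrix (Fin m) (Fin n) ℝ) : ℝ :=
  √(∑ i, ∑ j, A i j ^ 2)

/-- The `g`-norm: the largest Euclidean norm of a column. -/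
def normG {m n : ℕ} (A : Matrix (Fin m) (Fin n) ℝ) : ℝ :=
  ⨆ j : Fin n, √(∑ i, A i j ^ 2)

/-! ### The probabilities `P(λ)` and `Q(λ, k)` -/

/-- `P(λ) = 1 - 2 exp(-λ² (1 - u)² / 2)`. -/
def probP (u lam : ℝ) : ℝ := 1 - 2 * Real.exp (-(lam ^ 2 * (1 - u) ^ 2) / 2)

/-- `Q(λ, k) = 1 - k (1 - P(λ))`. -/
def probQ (u lam k : ℝ) : ℝ := 1 - k * (1 - probP u lam)

/-! ### Orders of evaluation of a sum -/

/-- A parenthesised sum: the leaves are the terms, every node is one addition. -/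
inductive SumOrder (ι : Type) : Type
  | leaf (i : ι) : SumOrder ι
  | node (l r : SumOrder ι) : SumOrder ι

namespace SumOrder

/-- The terms of the sum, from left to right. -/
def leaves {ι : Type} : SumOrder ι → List ι
  | leaf i => [i]
  | node l r => l.leaves ++ r.leaves

/-- Every index is the index of exactly one term. -/
def IsComplete {ι : Type} (t : SumOrder ι) : Prop :=
  t.leaves.Nodup ∧ ∀ i, i ∈ t.leaves

/-- Floating-point evaluation of the sum of the `x i`, where each addition `a + b` returns
`(a + b)(1 + η)`. The addition at a node of the tree is addressed by the path from the root to
that node (`false` is left, `true` is right). -/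
def eval {ι : Type} (x : ι → ℝ) : SumOrder ι → (List Bool → ℝ) → ℝ
  | leaf i, _ => x i
  | node l r, η =>
      (l.eval x (fun a => η (false :: a)) + r.eval x (fun a => η (true :: a))) * (1 + η [])

end SumOrder

/-- An order of evaluation for each of the sums that occur in one step of Shifted CholeskyQR for
an `m × n` matrix: the inner products in `TᵀT`, the expressions `aᵢⱼ - ∑_{k < i} vₖᵢ vₖⱼ` in the
Cholesky factorization and `tᵣⱼ - ∑_{k < j} qᵣₖ vₖⱼ` in the triangular solves. Here `none` stands
for the first term `aᵢⱼ` or `tᵣⱼ`, and `some k` for the product with index `k`. -/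
structure EvalOrder (m n : ℕ) where
  gram : Fin n → Fin n → SumOrder (Fin m)
  chol : (i : Fin n) → Fin n → SumOrder (Option {k : Fin n // k < i})
  solve : Fin m → (j : Fin n) → SumOrder (Option {k : Fin n // k < j})
  gram_complete : ∀ i j, (gram i j).IsComplete
  chol_complete : ∀ i j, (chol i j).IsComplete
  solve_complete : ∀ r j, (solve r j).IsComplete

/-! ### Shifted CholeskyQR in floating-point arithmetic -/

/-- Labels of the floating-point operations of one step of Shifted CholeskyQR. -/
inductive Op (m n : ℕ) : Type
  | gramMul (i j : Fin n) (k : Fin m)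
  | gramAdd (i j : Fin n) (a : List Bool)
  | shiftAdd (i : Fin n)
  | cholMul (i j k : Fin n)
  | cholAdd (i j : Fin n) (a : List Bool)
  | cholSqrt (i : Fin n)
  | cholDiv (i j : Fin n)
  | solveMul (r : Fin m) (j k : Fin n)
  | solveAdd (r : Fin m) (j : Fin n) (a : List Bool)
  | solveDiv (r : Fin m) (j : Fin n)

section Algorithm

variable {m n : ℕ}

/-- The computed Gram matrix `U = fl(TᵀT)`. -/
def gram (T : Matrix (Fin m) (Fin n) ℝ) (ord : EvalOrder m n) (δ : Op m n → ℝ) :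
    Matrix (Fin n) (Fin n) ℝ :=
  fun i j => (ord.gram i j).eval (fun k => T k i * T k j * (1 + δ (.gramMul i j k)))
    (fun a => δ (.gramAdd i j a))

/-- The computed shifted Gram matrix `fl(U + s I)`; only the diagonal takes part. -/
def shifted (U : Matrix (Fin n) (Fin n) ℝ) (s : ℝ) (δ : Op m n → ℝ) :
    Matrix (Fin n) (Fin n) ℝ :=
  fun i j => if i = j then (U i j + s) * (1 + δ (.shiftAdd i)) else U i j

/-- The computed value of `aᵢⱼ - ∑_{k < i} vₖᵢ vₖⱼ`, given the rows `v k` for `k < i`. -/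
def cholSum (A : Matrix (Fin n) (Fin n) ℝ) (ord : EvalOrder m n) (δ : Op m n → ℝ)
    (i j : Fin n) (v : {k : Fin n // k < i} → Fin n → ℝ) : ℝ :=
  (ord.chol i j).eval
    (fun o => match o with
      | none => A i j
      | some k => -(v k i * v k j * (1 + δ (.cholMul i j k))))
    (fun a => δ (.cholAdd i j a))

/-- Row `i` of the computed Cholesky factor: `vᵢᵢ` is the square root of the pivot
`aᵢᵢ - ∑_{k < i} vₖᵢ²` and, for `j > i`, `vᵢⱼ = (aᵢⱼ - ∑_{k < i} vₖᵢ vₖⱼ) / vᵢᵢ`. Only the upper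
triangle of `A` is read. -/
def cholRow (A : Matrix (Fin n) (Fin n) ℝ) (ord : EvalOrder m n) (δ : Op m n → ℝ)
    (i : Fin n) : Fin n → ℝ :=
  fun j =>
    if j = i then
      √(cholSum A ord δ i i (fun k => cholRow A ord δ k.1)) * (1 + δ (.cholSqrt i))
    else if i < j then
      cholSum A ord δ i j (fun k => cholRow A ord δ k.1) /
        (√(cholSum A ord δ i i (fun k => cholRow A ord δ k.1)) * (1 + δ (.cholSqrt i))) *
        (1 + δ (.cholDiv i j))
    else 0
termination_by i.val
decreasing_by all_goals exact k.2

/-- The computed pivot of which the `i`-th diagonal entry is the square root. -/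
def cholPivot (A : Matrix (Fin n) (Fin n) ℝ) (ord : EvalOrder m n) (δ : Op m n → ℝ)
    (i : Fin n) : ℝ :=
  cholSum A ord δ i i (fun k => cholRow A ord δ k.1)

/-- Row `r` of the computed solution of `Q V = T`, by substitution:
`qᵣⱼ = (tᵣⱼ - ∑_{k < j} qᵣₖ vₖⱼ) / vⱼⱼ`. -/
def solveRow (V : Matrix (Fin n) (Fin n) ℝ) (T : Matrix (Fin m) (Fin n) ℝ)
    (ord : EvalOrder m n) (δ : Op m n → ℝ) (r : Fin m) (j : Fin n) : ℝ :=
  (ord.solve r j).eval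
    (fun o => match o with
      | none => T r j
      | some k => -(solveRow V T ord δ r k.1 * V k.1 j * (1 + δ (.solveMul r j k.1))))
    (fun a => δ (.solveAdd r j a)) / V j j * (1 + δ (.solveDiv r j))
termination_by j.val
decreasing_by exact k.2

/-- The shifted Gram matrix that is handed to the Cholesky factorization. -/
def gramShifted (T : Matrix (Fin m) (Fin n) ℝ) (s : ℝ) (ord : EvalOrder m n)
    (δ : Op m n → ℝ) : Matrix (Fin n) (Fin n) ℝ :=
  shifted (gram T ord δ) s δ

/-- The algorithm runs to completion: no pivot is zero or negative. -/
def RunsToCompletion (T : Matrix (Fin m) (Fin n) ℝ) (s : ℝ) (ord : EvalOrder m n)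
    (δ : Op m n → ℝ) : Prop :=
  ∀ i, 0 < cholPivot (gramShifted T s ord δ) ord δ i

/-- The computed triangular factor `V`. -/
def factorV (T : Matrix (Fin m) (Fin n) ℝ) (s : ℝ) (ord : EvalOrder m n)
    (δ : Op m n → ℝ) : Matrix (Fin n) (Fin n) ℝ :=
  fun i j => cholRow (gramShifted T s ord δ) ord δ i j

/-- The computed orthogonal factor `Q`. -/
def factorQ (T : Matrix (Fin m) (Fin n) ℝ) (s : ℝ) (ord : EvalOrder m n)
    (δ : Op m n → ℝ) : Matrix (Fin m) (Fin n) ℝ :=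
  fun r j => solveRow (factorV T s ord δ) T ord δ r j

end Algorithm

/-- The probabilistic model of rounding errors: the relative errors `δ` of the operations are
independent random variables of mean zero, bounded in absolute value by the unit roundoff `u`. -/
structure RoundingModel {Ω κ : Type*} [MeasurableSpace Ω] (μ : Measure Ω) (u : ℝ)
    (δ : κ → Ω → ℝ) : Prop where
  measurable : ∀ o, Measurable (δ o)
  bound : ∀ o ω, |δ o ω| ≤ u
  mean_zero : ∀ o, ∫ ω, δ o ω ∂μ = 0
  indep : iIndepFun δ μ

end SCholQR

end

/-!
Each rounding error enters a computed sum through the evaluation tree: a term is multiplied by the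
product of the factors `1 + δ` along its path to the root. The logarithm of such a product, or of a
quotient of two of them, is up to second order a sum of the `δ` with fixed integer weights, and
Hoeffding's inequality bounds it outside an event whose probability depends only on the sum of
the squared weights (`RoundingModel.measureReal_path_le`). Since paths and weights do not depend on
the computed values, no conditioning on earlier stages of the algorithm is needed: all paths
are controlled at once on one event, `SmallDeviations`.

On this event the analysis is deterministic. The computed Gram matrix and the computed Cholesky
factor have entrywise errors of at most a small multiple of `λ √m u` and `λ √(n + 1) u`,
respectively, times the square of the largest column norm. The shift `s` is more than twice the
resulting perturbation in the spectral norm. Hence all pivots are positive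
(`sum_sq_partial_factor_lt`), and `‖V x‖² ≥ ‖T x‖² + (s / 2) ‖x‖²` for the computed factor `V`
(`sum_sq_mulVec_add_le`). The latter makes `T V⁻¹` a contraction and bounds `V⁻¹`, so that the
backward error of the substitution changes `Q` very little. Thus `‖Q x‖² ≤ 2 ‖x‖²`, which gives
`‖QᵀQ - I‖ ≤ 1`, and the Frobenius norm of `Q` exceeds `√n` by little at most, which gives the
residual bound (`sum_sq_residual_le_and_sum_sq_mulVec_le`).

The constants of the theorem leave room. The thresholds in `SmallDeviations` are `3`, `4` and `3 / 2`
times the natural ones, so the failure probability of one path is a power of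
`e = exp (-λ² (1 - u)² / 2)`, of exponent at least `2`; the union bound over all paths, including
those of all `m` rows of the substitution, then stays below `2 e`. So the success probability is at
least `P(λ)`, which is at least the product of the three `Q(λ, k)`.
-/

/-! ### Relative errors and weighted sums of rounding errors -/

namespace SCholQR

open Finset

lemma abs_log_one_add_sub_le {x : ℝ} (hx : |x| ≤ 1 / 2) : |Real.log (1 + x) - x| ≤ 2 * x ^ 2 := by
  have h := abs_le.1 hx
  have hp : 0 < 1 + x := by linarith
  have h1 := Real.log_le_sub_one_of_pos hp
  have h2 := Real.one_sub_inv_le_log_of_pos hp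
  have h3 : x - 2 * x ^ 2 ≤ 1 - (1 + x)⁻¹ := by
    have : 1 - (1 + x)⁻¹ = x / (1 + x) := by field_simp; ring
    rw [this, le_div_iff₀ hp]
    nlinarith [sq_nonneg x]
  rw [abs_le]
  constructor <;> nlinarith [sq_nonneg x]

/-- A positive number whose logarithm is at most `c X + X / 1100` in absolute value, with `X` tiny,
differs from `1` by little more than `c X`. -/
lemma abs_sub_one_le_of_abs_log_le {g c X : ℝ} (hg : 0 < g) (hc : c ≤ 4)
    (hX : X ≤ 1 / 2200) (h : |Real.log g| ≤ c * X + 2 * (X / 2200)) (hX0 : 0 ≤ X) :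
    |g - 1| ≤ (c + 1 / 100) * X := by
  have h4 : c * X ≤ 4 * X := by gcongr
  have h1 : |Real.log g| ≤ 1 := by linarith
  have h2 := Real.abs_exp_sub_one_sub_id_le h1
  rw [Real.exp_log hg] at h2
  have h3 : |g - 1| ≤ |Real.log g| + Real.log g ^ 2 := by
    have := abs_add_le (g - 1 - Real.log g) (Real.log g)
    rw [sub_add_cancel] at this
    linarith
  rw [← sq_abs] at h3
  have h0 := abs_nonneg (Real.log g)
  nlinarith

/-- The logarithm of a product of powers of factors `1 + η` is the weighted sum of the `η` up to
second order. -/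
lemma abs_sum_mul_log_sub_le {α : Type*} (S : Finset α) (w η : α → ℝ) {u K : ℝ} (hu : u ≤ 1 / 2)
    (hη : ∀ a, |η a| ≤ u) (hw : ∑ a ∈ S, |w a| ≤ K) :
    |∑ a ∈ S, w a * Real.log (1 + η a) - ∑ a ∈ S, w a * η a| ≤ 2 * (K * u ^ 2) := by
  rw [← sum_sub_distrib]
  calc _ ≤ ∑ a ∈ S, |w a * Real.log (1 + η a) - w a * η a| := abs_sum_le_sum_abs _ _
    _ ≤ ∑ a ∈ S, |w a| * (2 * u ^ 2) := by
        refine sum_le_sum fun a _ => ?_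
        rw [← mul_sub, abs_mul]
        gcongr
        refine (abs_log_one_add_sub_le ((hη a).trans hu)).trans ?_
        rw [← sq_abs]
        gcongr
        exact hη a
    _ = (∑ a ∈ S, |w a|) * (2 * u ^ 2) := by rw [sum_mul]
    _ ≤ K * (2 * u ^ 2) := by gcongr
    _ = _ := by ring

/-- Hoeffding's inequality for a weighted sum of rounding errors. -/
lemma RoundingModel.measureReal_weighted_sum_le {Ω κ : Type*} [MeasurableSpace Ω] {μ : Measure Ω}
    [IsProbabilityMeasure μ] {u : ℝ} {δ : κ → Ω → ℝ} (h : RoundingModel μ u δ) (hu : 0 < u)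
    (S : Finset κ) (w : κ → ℝ) {K τ : ℝ} (hK : ∑ a ∈ S, w a ^ 2 ≤ K) (hK0 : 0 < K) (hτ : 0 < τ) :
    μ.real {ω | τ ≤ |∑ a ∈ S, w a * δ a ω|} ≤ 2 * Real.exp (-(τ ^ 2 / (2 * (K * u ^ 2)))) := by
  have hsub : ∀ a, HasSubgaussianMGF (δ a) ((‖u - -u‖₊ / 2) ^ 2) μ := fun a =>
    hasSubgaussianMGF_of_mem_Icc_of_integral_eq_zero (h.measurable a).aemeasurable
      (Filter.Eventually.of_forall fun ω => abs_le.1 (h.bound a ω)) (h.mean_zero a)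
  have key : ∀ w : κ → ℝ, ∑ a ∈ S, w a ^ 2 ≤ K →
      μ.real {ω | τ ≤ ∑ a ∈ S, w a * δ a ω} ≤ Real.exp (-(τ ^ 2 / (2 * (K * u ^ 2)))) := by
    intro w hK
    have hind : iIndepFun (fun a ω => w a * δ a ω) μ :=
      h.indep.comp (fun a x => w a * x) fun a => measurable_const_mul (w a)
    let c : κ → NNReal := fun a => ⟨w a ^ 2 * u ^ 2, by positivity⟩
    have hc : ∀ a ∈ S, HasSubgaussianMGF (fun ω => w a * δ a ω) (c a) μ := fun a _ => by
      convert! (hsub a).const_mul (w a) using 1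
      refine NNReal.eq ?_
      have : ‖u - -u‖ / 2 = u := by
        rw [Real.norm_eq_abs, abs_of_pos (by linarith)]; ring
      change w a ^ 2 * u ^ 2 = w a ^ 2 * (‖u - -u‖ / 2) ^ 2
      rw [this]
    have h1 := HasSubgaussianMGF.sum_of_iIndepFun hind (s := S) hc
    have hval : ((∑ a ∈ S, c a : NNReal) : ℝ) = (∑ a ∈ S, w a ^ 2) * u ^ 2 := by
      rw [NNReal.coe_sum, sum_mul]
      rfl
    -- The parameter is enlarged to `K u ^ 2` first, so that it is positive even if `w` vanishes.
    have h2 : HasSubgaussianMGF (fun ω => ∑ a ∈ S, w a * δ a ω) ⟨K * u ^ 2, by positivity⟩ μ := by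
      refine ⟨h1.integrable_exp_mul, fun t => (h1.mgf_le t).trans (Real.exp_le_exp.2 ?_)⟩
      rw [hval]
      change _ ≤ K * u ^ 2 * t ^ 2 / 2
      gcongr
    have h3 := h2.measure_ge_le hτ.le
    rwa [neg_div] at h3
  have hsplit : {ω | τ ≤ |∑ a ∈ S, w a * δ a ω|} =
      {ω | τ ≤ ∑ a ∈ S, w a * δ a ω} ∪ {ω | τ ≤ ∑ a ∈ S, (-w a) * δ a ω} := by
    ext ω
    simp only [Set.mem_ofPred_eq, Set.mem_union, neg_mul, sum_neg_distrib, le_abs]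
  rw [hsplit, two_mul]
  exact (measureReal_union_le _ _).trans (add_le_add (key w hK) (key _ (by simpa using hK)))

end SCholQR

/-! ### Evaluation trees -/

namespace SCholQR.SumOrder

open Finset

variable {ι : Type}

open Classical in
/-- The addresses of the additions that the term with index `i` passes through on its way to the
root. -/
noncomputable def anc : SumOrder ι → ι → Finset (List Bool)
  | leaf _, _ => ∅
  | node l r, i => insert [] (if i ∈ l.leaves then (l.anc i).image (List.cons false)
      else (r.anc i).image (List.cons true))

/-- The addresses of all additions of an evaluation tree. -/
def nodes : SumOrder ι → Finset (List Bool)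
  | leaf _ => ∅
  | node l r => insert [] (l.nodes.image (List.cons false) ∪ r.nodes.image (List.cons true))

lemma anc_subset_nodes (t : SumOrder ι) (i : ι) : t.anc i ⊆ t.nodes := by
  induction t with
  | leaf _ => simp [anc]
  | node l r hl hr =>
    rw [anc, nodes]
    refine insert_subset_insert _ ?_
    split_ifs
    · exact (image_subset_image hl).trans subset_union_left
    · exact (image_subset_image hr).trans subset_union_right

lemma card_nodes_lt (t : SumOrder ι) : #t.nodes + 1 ≤ t.leaves.length := by
  induction t with
  | leaf _ => simp [nodes, leaves]
  | node l r hl hr =>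
    rw [nodes, leaves, List.length_append]
    have h1 := card_insert_le ([] : List Bool)
      (l.nodes.image (List.cons false) ∪ r.nodes.image (List.cons true))
    have h2 := card_union_le (l.nodes.image (List.cons false)) (r.nodes.image (List.cons true))
    have h3 : #(l.nodes.image (List.cons false)) ≤ _ := card_image_le
    have h4 : #(r.nodes.image (List.cons true)) ≤ _ := card_image_le
    omega

/-- Every term enters the computed sum multiplied by the factors `1 + η` of the additions above
it. -/
lemma eval_eq_sum_map (x : ι → ℝ) (t : SumOrder ι) (η : List Bool → ℝ) (ht : t.leaves.Nodup) :
    t.eval x η = (t.leaves.map fun i => x i * ∏ a ∈ t.anc i, (1 + η a)).sum := by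
  induction t generalizing η with
  | leaf _ => simp [anc, leaves, eval]
  | node l r hl hr =>
    rw [leaves, List.nodup_append] at ht
    obtain ⟨htl, htr, hd⟩ := ht
    rw [eval, hl _ htl, hr _ htr, leaves, List.map_append, List.sum_append, add_mul,
      ← List.sum_map_mul_right, ← List.sum_map_mul_right]
    congr 2
    · refine List.map_congr_left fun i hi => ?_
      rw [anc, if_pos hi, prod_insert (by simp), prod_image (by simp)]
      ring
    · refine List.map_congr_left fun i hi => ?_
      have : i ∉ l.leaves := fun h => hd i h i hi rfl
      rw [anc, if_neg this, prod_insert (by simp), prod_image (by simp)]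
      ring

variable [Fintype ι]

lemma IsComplete.sum_map {t : SumOrder ι} (ht : t.IsComplete) (f : ι → ℝ) :
    (t.leaves.map f).sum = ∑ i, f i := by
  classical
  rw [← List.sum_toFinset _ ht.1]
  congr 1
  ext i
  simp [ht.2 i]

lemma IsComplete.eval_eq_sum {t : SumOrder ι} (ht : t.IsComplete) (x : ι → ℝ)
    (η : List Bool → ℝ) :
    t.eval x η = ∑ i, x i * ∏ a ∈ t.anc i, (1 + η a) := by
  rw [eval_eq_sum_map _ _ _ ht.1, ht.sum_map]

lemma IsComplete.card_nodes_lt {t : SumOrder ι} (ht : t.IsComplete) :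
    #t.nodes + 1 ≤ Fintype.card ι := by
  have h : t.leaves.length = Fintype.card ι := by
    have := ht.sum_map fun _ => (1 : ℝ)
    simpa using this
  exact h ▸ t.card_nodes_lt

end SCholQR.SumOrder

/-! ### Relative errors of a computed sum -/

namespace SCholQR

open Finset

lemma one_add_pos {x u : ℝ} (hu : u ≤ 1 / 2) (hx : |x| ≤ u) : 0 < 1 + x := by
  have := (abs_le.1 hx).1
  linarith

/-- A product of powers of rounding factors is close to `1` if the corresponding weighted sum of
rounding errors is small. -/
lemma abs_sub_one_le_of_log_eq {α : Type*} (S : Finset α) (w η : α → ℝ) {g b ε u c X : ℝ}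
    (hg : 0 < g) (hlog : Real.log g = b * Real.log (1 + ε) + ∑ a ∈ S, w a * Real.log (1 + η a))
    (hgood : |b * ε + ∑ a ∈ S, w a * η a| ≤ c * X) (hw : ∀ a, |w a| ≤ 1)
    (hε : |ε| ≤ u) (hη : ∀ a, |η a| ≤ u) (hu : u ≤ 1 / 2)
    (hK : (#S + |b|) * u ^ 2 ≤ X / 2200) (hc : c ≤ 4) (hX0 : 0 ≤ X) (hX : X ≤ 1 / 2200) :
    |g - 1| ≤ (c + 1 / 100) * X := by
  have h := abs_sum_mul_log_sub_le (insertNone S) (fun o => o.elim b w) (fun o => o.elim ε η)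
    (K := #S + |b|) hu (by rintro (_ | a) <;> simp [hε, hη]) (by
      rw [sum_insertNone]
      simp only [Option.elim_none, Option.elim_some]
      have := sum_le_card_nsmul S (fun a => |w a|) 1 fun a _ => hw a
      simp only [nsmul_eq_mul, mul_one] at this
      linarith)
  simp only [sum_insertNone, Option.elim_none, Option.elim_some] at h
  rw [← hlog] at h
  refine abs_sub_one_le_of_abs_log_le hg hc hX ?_ hX0
  have h2 := abs_add_le (Real.log g - (b * ε + ∑ a ∈ S, w a * η a))
    (b * ε + ∑ a ∈ S, w a * η a)
  rw [sub_add_cancel] at h2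
  linarith

end SCholQR

namespace SCholQR.SumOrder

open Finset

variable {ι : Type}

open Classical in
/-- The indicator function of the additions above the term with index `i`. -/
noncomputable def weight (t : SumOrder ι) (i : ι) (a : List Bool) : ℝ :=
  if a ∈ t.anc i then 1 else 0

lemma sum_weight_mul (t : SumOrder ι) (i : ι) (f : List Bool → ℝ) :
    ∑ a ∈ t.nodes, t.weight i a * f a = ∑ a ∈ t.anc i, f a := by
  classical
  simp only [weight, ite_mul, one_mul, zero_mul]
  rw [← sum_filter, filter_mem_eq_inter, inter_eq_right.2 (t.anc_subset_nodes i)]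

lemma abs_weight_le (t : SumOrder ι) (i : ι) (a : List Bool) : |t.weight i a| ≤ 1 := by
  unfold weight
  split_ifs <;> simp

/-- The exponents with which the rounding factors of the additions enter after division by the
factor of the term `none`. The sign for `none` itself is irrelevant and taken positive. -/
noncomputable def relWeight {κ : Type} (t : SumOrder (Option κ)) : Option κ → List Bool → ℝ
  | none, a => t.weight none a
  | some k, a => t.weight (some k) a - t.weight none a

lemma abs_relWeight_le {κ : Type} (t : SumOrder (Option κ)) (o : Option κ) (a : List Bool) :
    |t.relWeight o a| ≤ 1 := by
  cases o with
  | none => exact t.abs_weight_le none a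
  | some k =>
    simp only [relWeight, weight]
    split_ifs <;> simp

lemma log_prod_anc (t : SumOrder ι) (i : ι) {η : List Bool → ℝ} (hη : ∀ a, 0 < 1 + η a) :
    Real.log (∏ a ∈ t.anc i, (1 + η a)) = ∑ a ∈ t.nodes, t.weight i a * Real.log (1 + η a) := by
  rw [sum_weight_mul, Real.log_prod fun a _ => (hη a).ne']

variable {u c X : ℝ}

/-- Forward error of a computed inner product. -/
lemma IsComplete.exists_eval_eq [Fintype ι] {t : SumOrder ι} (ht : t.IsComplete) (p ε : ι → ℝ)
    (η : List Bool → ℝ) (hu : u ≤ 1 / 2) (hε : ∀ i, |ε i| ≤ u) (hη : ∀ a, |η a| ≤ u)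
    (hgood : ∀ i, |1 * ε i + ∑ a ∈ t.nodes, t.weight i a * η a| ≤ c * X)
    (hK : Fintype.card ι * u ^ 2 ≤ X / 2200) (hc : c ≤ 4) (hX0 : 0 ≤ X) (hX : X ≤ 1 / 2200) :
    ∃ θ : ι → ℝ, (∀ i, |θ i| ≤ (c + 1 / 100) * X) ∧
      t.eval (fun i => p i * (1 + ε i)) η = ∑ i, p i * (1 + θ i) := by
  have hη0 : ∀ a, 0 < 1 + η a := fun a => one_add_pos hu (hη a)
  refine ⟨fun i => (1 + ε i) * ∏ a ∈ t.anc i, (1 + η a) - 1, fun i => ?_, ?_⟩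
  · have h1 : 0 < ∏ a ∈ t.anc i, (1 + η a) := prod_pos fun a _ => hη0 a
    have h2 := one_add_pos hu (hε i)
    refine abs_sub_one_le_of_log_eq t.nodes (t.weight i) η (by positivity) ?_ (hgood i)
      (t.abs_weight_le i) (hε i) hη hu ?_ hc hX0 hX
    · rw [Real.log_mul h2.ne' h1.ne', t.log_prod_anc i hη0, one_mul]
    · refine le_trans ?_ hK
      have := ht.card_nodes_lt
      rw [abs_one]
      gcongr
      exact_mod_cast this
  · rw [ht.eval_eq_sum]
    refine sum_congr rfl fun i _ => ?_
    ring

/-- Backward error of a computed expression `a - ∑ k, p k`: after one more division or square root,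
which contributes the factor `(1 + ε₀) ^ b`, the first term `a` is recovered up to relative errors
in the other terms and in the result. -/
lemma IsComplete.exists_eq_eval_add_sum {κ : Type} [Fintype κ] {t : SumOrder (Option κ)}
    (ht : t.IsComplete) (x : Option κ → ℝ) (p ε : κ → ℝ) (ε₀ : ℝ) {b : ℕ} (hb : 1 ≤ b)
    (η : List Bool → ℝ) (hx : ∀ k, x (some k) = -(p k * (1 + ε k)))
    (hu : u ≤ 1 / 2) (hε : ∀ i, |ε i| ≤ u) (hε₀ : |ε₀| ≤ u) (hη : ∀ a, |η a| ≤ u)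
    (hgood₀ : |b * ε₀ + ∑ a ∈ t.nodes, t.relWeight none a * η a| ≤ c * X)
    (hgood : ∀ k, |1 * ε k + ∑ a ∈ t.nodes, t.relWeight (some k) a * η a| ≤ c * X)
    (hK : (Fintype.card κ + b : ℝ) * u ^ 2 ≤ X / 2200) (hc : c ≤ 4) (hX0 : 0 ≤ X)
    (hX : X ≤ 1 / 2200) :
    ∃ θ : Option κ → ℝ, (∀ o, |θ o| ≤ (c + 1 / 100) * X) ∧
      x none = t.eval x η * (1 + ε₀) ^ b * (1 + θ none) + ∑ k, p k * (1 + θ (some k)) := by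
  have hη0 : ∀ a, 0 < 1 + η a := fun a => one_add_pos hu (hη a)
  have hF : ∀ o, 0 < ∏ a ∈ t.anc o, (1 + η a) := fun o => prod_pos fun a _ => hη0 a
  have hcard : (#t.nodes : ℝ) ≤ Fintype.card κ := by
    have := ht.card_nodes_lt
    rw [Fintype.card_option] at this
    exact_mod_cast Nat.le_of_succ_le_succ this
  have hb' : (1 : ℝ) ≤ b := by exact_mod_cast hb
  have h₀ := one_add_pos hu hε₀
  refine ⟨fun o => o.elim (((1 + ε₀) ^ b * ∏ a ∈ t.anc none, (1 + η a))⁻¹ - 1)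
    fun k => (1 + ε k) * (∏ a ∈ t.anc (some k), (1 + η a)) / (∏ a ∈ t.anc none, (1 + η a)) - 1,
    ?_, ?_⟩
  · rintro (_ | k)
    · have h1 := hF none
      refine abs_sub_one_le_of_log_eq t.nodes (fun a => -t.relWeight none a) η (b := -b) (ε := ε₀)
        (by positivity) ?_ ?_ (fun a => by rw [abs_neg]; exact t.abs_relWeight_le none a)
        hε₀ hη hu ?_ hc hX0 hX
      · rw [Real.log_inv, Real.log_mul (by positivity) h1.ne', Real.log_pow, t.log_prod_anc _ hη0]
        simp only [relWeight, neg_mul, sum_neg_distrib]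
        ring
      · rw [← abs_neg]
        convert hgood₀ using 2
        simp only [neg_mul, sum_neg_distrib]
        ring
      · refine le_trans ?_ hK
        rw [abs_neg, abs_of_nonneg (by positivity)]
        gcongr
    · have h1 := hF none
      have h2 := hF (some k)
      have h3 := one_add_pos hu (hε k)
      refine abs_sub_one_le_of_log_eq t.nodes (t.relWeight (some k)) η
        (by positivity) ?_ (hgood k) (t.abs_relWeight_le _) (hε k) hη hu ?_ hc hX0 hX
      · rw [Real.log_div (by positivity) h1.ne', Real.log_mul h3.ne' h2.ne', t.log_prod_anc _ hη0,
          t.log_prod_anc _ hη0, one_mul, add_sub_assoc, ← sum_sub_distrib]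
        simp only [relWeight, sub_mul]
      · refine le_trans ?_ hK
        rw [abs_one]
        gcongr
  · have h1 := (hF none).ne'
    have h2 := h₀.ne'
    rw [ht.eval_eq_sum, Fintype.sum_option]
    simp only [Option.elim_none, Option.elim_some, hx, add_sub_cancel]
    have h3 : ∀ k, p k * ((1 + ε k) * (∏ a ∈ t.anc (some k), (1 + η a)) /
        ∏ a ∈ t.anc none, (1 + η a)) =
        -(-(p k * (1 + ε k)) * ∏ a ∈ t.anc (some k), (1 + η a)) /
          ∏ a ∈ t.anc none, (1 + η a) := fun k => by ring
    simp only [h3]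
    rw [← sum_div, sum_neg_distrib]
    field_simp
    ring

end SCholQR.SumOrder

/-! ### The probability that all accumulated rounding errors are small -/

namespace SCholQR

open Finset

variable {m n : ℕ}

/-- The operation that multiplies a term of a Cholesky sum, or, for `none`, the operation that is
applied to the computed sum. -/
def cholOp (i j : Fin n) : Option {k : Fin n // k < i} → Op m n
  | none => if i = j then .cholSqrt i else .cholDiv i j
  | some k => .cholMul i j k

/-- The exponent with which the rounding factor of `cholOp i j o` enters. It is `2` for the square
root: the diagonal entry of the factor is squared when the matrix is recovered. -/
def cholExp (i j : Fin n) : Option {k : Fin n // k < i} → ℕ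
  | none => if i = j then 2 else 1
  | some _ => 1

/-- The operation that multiplies a term of a substitution sum, or, for `none`, the division of the
computed sum. -/
def solveOp (r : Fin m) (j : Fin n) : Option {k : Fin n // k < j} → Op m n
  | none => .solveDiv r j
  | some k => .solveMul r j k

/-- The event, as a condition on a realization `δ` of the rounding errors, that the weighted sums of
rounding errors along all paths in the evaluation trees are of the order that Hoeffding's
inequality predicts. The paths and weights do not depend on `δ`. -/
structure SmallDeviations (ord : EvalOrder m n) (lam u : ℝ) (δ : Op m n → ℝ) : Prop where
  gram : ∀ i j k, |1 * δ (.gramMul i j k) + ∑ a ∈ (ord.gram i j).nodes,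
    (ord.gram i j).weight k a * δ (.gramAdd i j a)| ≤ 3 * (lam * √m * u)
  chol : ∀ i j o, |cholExp i j o * δ (cholOp i j o) + ∑ a ∈ (ord.chol i j).nodes,
    (ord.chol i j).relWeight o a * δ (.cholAdd i j a)| ≤ 4 * (lam * √(n + 1) * u)
  solve : ∀ r j o, |1 * δ (solveOp r j o) + ∑ a ∈ (ord.solve r j).nodes,
    (ord.solve r j).relWeight o a * δ (.solveAdd r j a)| ≤ 3 / 2 * (lam * √n * u)

lemma measureReal_iUnion_le_card_mul {Ω ι : Type*} [MeasurableSpace Ω] {μ : Measure Ω}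
    [Fintype ι] (B : ι → Set Ω) {N : ℕ} {c : ℝ}
    (hc : 0 ≤ c) (hN : Fintype.card ι ≤ N) (hB : ∀ i, μ.real (B i) ≤ c) :
    μ.real (⋃ i, B i) ≤ N * c := by
  refine (measureReal_iUnion_fintype_le B).trans ?_
  refine (sum_le_card_nsmul univ _ c fun i _ => hB i).trans ?_
  rw [nsmul_eq_mul, card_univ]
  gcongr

section Probability

variable {Ω : Type*} [MeasurableSpace Ω] {μ : Measure Ω} [IsProbabilityMeasure μ] {u lam : ℝ}

/-- Hoeffding's inequality for one path, in terms of a power of the tail `exp (-λ²(1 - u)²/2)`. -/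
lemma RoundingModel.measureReal_path_le {δ : Op m n → Ω → ℝ} (h : RoundingModel μ u δ)
    (hu : 0 < u) (hu1 : u ≤ 1) (N : Finset (List Bool)) (w : List Bool → ℝ)
    (hw : ∀ a, |w a| ≤ 1) {φ : Option (List Bool) → Op m n} (hφ : φ.Injective) {b K τ : ℝ}
    (hK : #N + b ^ 2 ≤ K) (hK0 : 0 < K) (hτ : 0 < τ) {p : ℕ}
    (hp : p * (lam ^ 2 * (K * u ^ 2)) ≤ τ ^ 2) :
    μ.real {ω | τ < |b * δ (φ none) ω + ∑ a ∈ N, w a * δ (φ (some a)) ω|} ≤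
      2 * Real.exp (-(lam ^ 2 * (1 - u) ^ 2) / 2) ^ p := by
  have h' : RoundingModel μ u (fun o => δ (φ o)) :=
    ⟨fun o => h.measurable _, fun o => h.bound _, fun o => h.mean_zero _, h.indep.precomp hφ⟩
  have h1 := h'.measureReal_weighted_sum_le hu (insertNone N) (fun o => o.elim b w) (K := K)
    (by
      rw [sum_insertNone]
      simp only [Option.elim_none, Option.elim_some]
      have := sum_le_card_nsmul N (fun a => w a ^ 2) 1 fun a _ => by
        rw [← sq_abs]; exact pow_le_one₀ (abs_nonneg _) (hw a)
      simp only [nsmul_eq_mul, mul_one] at this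
      linarith) hK0 hτ
  simp only [sum_insertNone, Option.elim_none, Option.elim_some] at h1
  refine (measureReal_mono fun ω (hω : τ < _) => hω.le).trans (h1.trans ?_)
  rw [← Real.exp_nat_mul]
  gcongr
  have h2 : (1 - u) ^ 2 ≤ 1 := pow_le_one₀ (by linarith) (by linarith)
  have h3 : p * lam ^ 2 / 2 ≤ τ ^ 2 / (2 * (K * u ^ 2)) := by
    rw [div_le_div_iff₀ (by positivity) (by positivity)]
    nlinarith
  have h4 : (p : ℝ) * (lam ^ 2 * (1 - u) ^ 2) ≤ p * (lam ^ 2 * 1) := by gcongr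
  linarith

lemma card_option_lt_le (i : Fin n) : Fintype.card (Option {k : Fin n // k < i}) ≤ n := by
  rw [Fintype.card_option]
  have := Fintype.card_subtype_lt (p := fun k : Fin n => k < i) (x := i) (lt_irrefl i)
  rw [Fintype.card_fin] at this
  exact this

lemma EvalOrder.card_nodes_chol_lt (ord : EvalOrder m n) (i j : Fin n) :
    #(ord.chol i j).nodes + 1 ≤ n :=
  (ord.chol_complete i j).card_nodes_lt.trans (card_option_lt_le i)

lemma EvalOrder.card_nodes_solve_lt (ord : EvalOrder m n) (r : Fin m) (j : Fin n) :
    #(ord.solve r j).nodes + 1 ≤ n :=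
  (ord.solve_complete r j).card_nodes_lt.trans (card_option_lt_le j)

/-- All paths behave with probability at least `1 - 2 exp (-λ²(1 - u)²/2)`, the bound for a single
path with threshold `λ`: the thresholds in `SmallDeviations` exceed those with `λ` by constant
factors, which turns the tail probability into a power of it and outweighs the number of paths. -/
lemma RoundingModel.le_measureReal_smallDeviations {δ : Op m n → Ω → ℝ} (h : RoundingModel μ u δ)
    (hu : 0 < u) (hu1 : u ≤ 1) (hlam : 0 < lam) (hm : 1 ≤ m) (hn : 1 ≤ n) (ord : EvalOrder m n)
    (hQ₁ : 0 < probQ u lam ((m : ℝ) * n ^ 2))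
    (hQ₂ : 0 < probQ u lam ((n : ℝ) ^ 3 / 6 + (n : ℝ) ^ 2 / 2 + (n : ℝ) / 3)) :
    probP u lam ≤ μ.real {ω | SmallDeviations ord lam u (fun o => δ o ω)} := by
  unfold probQ probP at *
  set e := Real.exp (-(lam ^ 2 * (1 - u) ^ 2) / 2) with he
  have he0 : 0 < e := Real.exp_pos _
  have hm' : (1 : ℝ) ≤ m := by exact_mod_cast hm
  have hn' : (1 : ℝ) ≤ n := by exact_mod_cast hn
  set bg : Fin n → Fin n → Fin m → Set Ω := fun i j k =>
    {ω | 3 * (lam * √m * u) < |1 * δ (.gramMul i j k) ω + ∑ a ∈ (ord.gram i j).nodes,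
      (ord.gram i j).weight k a * δ (.gramAdd i j a) ω|} with hbg
  set bc : (i : Fin n) → Fin n → Option {k : Fin n // k < i} → Set Ω := fun i j o =>
    {ω | 4 * (lam * √(n + 1) * u) < |cholExp i j o * δ (cholOp i j o) ω +
      ∑ a ∈ (ord.chol i j).nodes, (ord.chol i j).relWeight o a * δ (.cholAdd i j a) ω|} with hbc
  set bs : Fin m → (j : Fin n) → Option {k : Fin n // k < j} → Set Ω := fun r j o =>
    {ω | 3 / 2 * (lam * √n * u) < |1 * δ (solveOp r j o) ω +
      ∑ a ∈ (ord.solve r j).nodes, (ord.solve r j).relWeight o a * δ (.solveAdd r j a) ω|} with hbs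
  have hg : ∀ i j k, μ.real (bg i j k) ≤ 2 * e ^ 9 := by
    intro i j k
    refine h.measureReal_path_le hu hu1 _ _ (SumOrder.abs_weight_le _ k)
      (φ := fun o => o.elim (.gramMul i j k) (.gramAdd i j)) ?_ (K := m) ?_ (by positivity)
      (by positivity) ?_
    · rintro (_ | a) (_ | b) <;> simp
    · have := (ord.gram_complete i j).card_nodes_lt
      rw [Fintype.card_fin] at this
      rw [one_pow]
      exact_mod_cast this
    · rw [mul_pow, mul_pow, mul_pow, Real.sq_sqrt (by positivity)]
      apply le_of_eq
      push_cast
      ring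
  have hc : ∀ i j o, μ.real (bc i j o) ≤ 2 * e ^ 8 := by
    intro i j o
    refine h.measureReal_path_le hu hu1 _ _ (SumOrder.abs_relWeight_le _ o)
      (φ := fun p => p.elim (cholOp i j o) (.cholAdd i j)) ?_ (K := 2 * (n + 1)) ?_ (by positivity)
      (by positivity) ?_
    · have hne : ∀ a, cholOp (m := m) i j o ≠ .cholAdd i j a := by
        intro a
        rcases o with _ | k
        · simp only [cholOp]; split_ifs <;> simp
        · simp [cholOp]
      rintro (_ | a) (_ | b) <;> simp [hne, (hne _).symm]
    · have h1 := ord.card_nodes_chol_lt i j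
      have h2 : cholExp i j o ^ 2 ≤ 4 := by
        rcases o with _ | k
        · simp only [cholExp]; split_ifs <;> simp
        · simp [cholExp]
      have h3 : #(ord.chol i j).nodes + cholExp i j o ^ 2 ≤ 2 * (n + 1) := by omega
      exact_mod_cast h3
    · rw [mul_pow, mul_pow, mul_pow, Real.sq_sqrt (by positivity)]
      apply le_of_eq
      push_cast
      ring
  have hs : ∀ r j o, μ.real (bs r j o) ≤ 2 * e ^ 2 := by
    intro r j o
    refine h.measureReal_path_le hu hu1 _ _ (SumOrder.abs_relWeight_le _ o)
      (φ := fun p => p.elim (solveOp r j o) (.solveAdd r j)) ?_ (K := n) ?_ (by positivity)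
      (by positivity) ?_
    · have hne : ∀ a, solveOp (m := m) r j o ≠ .solveAdd r j a := by
        intro a
        rcases o with _ | k <;> simp [solveOp]
      rintro (_ | a) (_ | b) <;> simp [hne, (hne _).symm]
    · have h1 := ord.card_nodes_solve_lt r j
      rw [one_pow]
      exact_mod_cast h1
    · rw [mul_pow, mul_pow, mul_pow, Real.sq_sqrt (by positivity)]
      push_cast
      have : 0 ≤ lam ^ 2 * n * u ^ 2 := by positivity
      linarith
  have hG : μ.real (⋃ i, ⋃ j, ⋃ k, bg i j k) ≤ n * (n * (m * (2 * e ^ 9))) := by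
    refine measureReal_iUnion_le_card_mul _ (by positivity) (by simp) fun i => ?_
    refine measureReal_iUnion_le_card_mul _ (by positivity) (by simp) fun j => ?_
    exact measureReal_iUnion_le_card_mul _ (by positivity) (by simp) fun k => hg i j k
  have hC : μ.real (⋃ i, ⋃ j, ⋃ o, bc i j o) ≤ n * (n * (n * (2 * e ^ 8))) := by
    refine measureReal_iUnion_le_card_mul _ (by positivity) (by simp) fun i => ?_
    refine measureReal_iUnion_le_card_mul _ (by positivity) (by simp) fun j => ?_
    exact measureReal_iUnion_le_card_mul _ (by positivity) (card_option_lt_le i) fun k => hc i j k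
  have hS : μ.real (⋃ r, ⋃ j, ⋃ o, bs r j o) ≤ m * (n * (n * (2 * e ^ 2))) := by
    refine measureReal_iUnion_le_card_mul _ (by positivity) (by simp) fun i => ?_
    refine measureReal_iUnion_le_card_mul _ (by positivity) (by simp) fun j => ?_
    exact measureReal_iUnion_le_card_mul _ (by positivity) (card_option_lt_le j) fun k => hs i j k
  have hcover : (Set.univ : Set Ω) ⊆ {ω | SmallDeviations ord lam u (fun o => δ o ω)} ∪
      ((⋃ i, ⋃ j, ⋃ k, bg i j k) ∪ ((⋃ i, ⋃ j, ⋃ o, bc i j o) ∪ (⋃ r, ⋃ j, ⋃ o, bs r j o))) := by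
    intro ω _
    by_contra hω
    simp only [Set.mem_union, Set.mem_iUnion, not_or, not_exists, hbg, hbc, hbs,
      Set.mem_ofPred_eq, not_lt] at hω
    exact hω.1 ⟨hω.2.1, hω.2.2.1, hω.2.2.2⟩
  have htot : 1 ≤ μ.real {ω | SmallDeviations ord lam u (fun o => δ o ω)} +
      (n * (n * (m * (2 * e ^ 9))) + (n * (n * (n * (2 * e ^ 8))) +
        m * (n * (n * (2 * e ^ 2))))) := by
    have h1 := measureReal_mono (μ := μ) hcover
    rw [probReal_univ] at h1
    refine h1.trans ((measureReal_union_le _ _).trans ?_)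
    gcongr
    refine (measureReal_union_le _ _).trans ?_
    gcongr
    refine (measureReal_union_le _ _).trans ?_
    gcongr
  have h1 : (m : ℝ) * n ^ 2 * (2 * e) ≤ 1 := by linarith
  have h2 : (n : ℝ) ^ 3 * (2 * e) ≤ 6 := by
    have : 0 ≤ (n : ℝ) ^ 2 * e := by positivity
    have : 0 ≤ (n : ℝ) * e := by positivity
    linarith
  have h3 : e ≤ 1 / 2 := by
    have : (1 : ℝ) ≤ m * n ^ 2 := one_le_mul_of_one_le_of_one_le hm' (one_le_pow₀ hn')
    nlinarith
  have h4 : (n : ℝ) * (n * (m * (2 * e ^ 9))) ≤ e * (1 / 2) ^ 7 := by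
    calc (n : ℝ) * (n * (m * (2 * e ^ 9))) = (m * n ^ 2 * (2 * e)) * (e * e ^ 7) := by ring
      _ ≤ 1 * (e * (1 / 2) ^ 7) := by gcongr
      _ = _ := by ring
  have h5 : (n : ℝ) * (n * (n * (2 * e ^ 8))) ≤ e * (6 * (1 / 2) ^ 6) := by
    calc (n : ℝ) * (n * (n * (2 * e ^ 8))) = (n ^ 3 * (2 * e)) * (e * e ^ 6) := by ring
      _ ≤ 6 * (e * (1 / 2) ^ 6) := by gcongr
      _ = _ := by ring
  have h6 : (m : ℝ) * (n * (n * (2 * e ^ 2))) ≤ e := by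
    calc (m : ℝ) * (n * (n * (2 * e ^ 2))) = (m * n ^ 2 * (2 * e)) * e := by ring
      _ ≤ 1 * e := by gcongr
      _ = _ := by ring
  linarith

end Probability

end SCholQR

/-! ### Quadratic forms and partial Cholesky factors -/

namespace SCholQR

open Finset Matrix

variable {m n : ℕ}

lemma abs_quadForm_le {E : Matrix (Fin n) (Fin n) ℝ} {e : ℝ} (hE : ∀ j l, |E j l| ≤ e)
    (x : Fin n → ℝ) : |∑ j, ∑ l, x j * x l * E j l| ≤ n * e * ∑ j, x j ^ 2 := by
  rcases isEmpty_or_nonempty (Fin n) with h0 | ⟨⟨i⟩⟩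
  · simp
  have he : 0 ≤ e := (abs_nonneg _).trans (hE i i)
  calc |∑ j, ∑ l, x j * x l * E j l| ≤ ∑ j, ∑ l, |x j| * |x l| * e := by
        refine (abs_sum_le_sum_abs _ _).trans (sum_le_sum fun j _ => ?_)
        refine (abs_sum_le_sum_abs _ _).trans (sum_le_sum fun l _ => ?_)
        rw [abs_mul, abs_mul]
        gcongr
        exact hE j l
    _ = (∑ j, |x j|) ^ 2 * e := by
        rw [sq, sum_mul_sum, sum_mul]
        simp only [sum_mul]
    _ ≤ (n * ∑ j, |x j| ^ 2) * e := by
        gcongr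
        simpa using sq_sum_le_card_mul_sum_sq (s := univ) (f := fun j => |x j|)
    _ = _ := by simp only [sq_abs]; ring

lemma sum_sq_mulVec_le (A : Matrix (Fin m) (Fin n) ℝ) (x : Fin n → ℝ) :
    ∑ r, (A *ᵥ x) r ^ 2 ≤ (∑ r, ∑ j, A r j ^ 2) * ∑ j, x j ^ 2 := by
  rw [sum_mul]
  exact sum_le_sum fun r _ => sum_mul_sq_le_sq_mul_sq univ (A r) x

lemma sum_sq_mulVec_eq (A : Matrix (Fin m) (Fin n) ℝ) (x : Fin n → ℝ) :
    ∑ r, (A *ᵥ x) r ^ 2 = ∑ j, ∑ l, x j * x l * ∑ r, A r j * A r l := by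
  simp only [mulVec, dotProduct, sq, sum_mul_sum]
  rw [sum_comm]
  refine sum_congr rfl fun j _ => ?_
  rw [sum_comm]
  refine sum_congr rfl fun l _ => ?_
  rw [mul_sum]
  refine sum_congr rfl fun r _ => ?_
  ring

/-- A vector annihilated by the rows above `i` of a partial triangular factor. -/
lemma exists_kernel_of_partial_factor (R : Matrix (Fin n) (Fin n) ℝ) (i : Fin n)
    (htri : ∀ k j, j < k → R k j = 0) (hdiag : ∀ k < i, R k k ≠ 0) :
    ∃ x : Fin n → ℝ, x i = 1 ∧ (∀ k, i < k → x k = 0) ∧ ∀ k < i, (R *ᵥ x) k = 0 := by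
  set N : Matrix (Fin n) (Fin n) ℝ := fun k j => if k < i then R k j else if k = j then 1 else 0
    with hN
  have hNtri : N.BlockTriangular id := by
    intro k j hjk
    have hjk : j < k := hjk
    simp only [hN]
    split_ifs with h1 h2
    · exact htri k j hjk
    · exact absurd h2 hjk.ne'
    · rfl
  have hdet : N.det ≠ 0 := by
    rw [det_of_isUpperTriangular hNtri, prod_ne_zero_iff]
    intro k _
    simp only [hN]
    split_ifs with h1
    · exact hdiag k h1
    · exact one_ne_zero
  have hx : N *ᵥ (N⁻¹ *ᵥ Pi.single i 1) = Pi.single i 1 := by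
    rw [mulVec_mulVec, mul_nonsing_inv _ (isUnit_iff_ne_zero.2 hdet), one_mulVec]
  set x := N⁻¹ *ᵥ Pi.single i 1 with hxdef
  have hge : ∀ k, ¬k < i → x k = (Pi.single i 1 : Fin n → ℝ) k := by
    intro k hk
    rw [← hx]
    simp [mulVec, dotProduct, hN, hk]
  refine ⟨x, by rw [hge i (lt_irrefl i)]; simp, fun k hk => ?_, fun k hk => ?_⟩
  · rw [hge k hk.not_gt, Pi.single_eq_of_ne hk.ne']
  · have := congrFun hx k
    rw [Pi.single_eq_of_ne hk.ne] at this
    rw [← this]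
    simp [mulVec, dotProduct, hN, hk]

/-- Positivity of the next pivot. The rows above `i` of the factor reproduce the form `a` on the
leading coordinates up to small errors, except for the entry `(i, i)`. On a vector annihilated by
these rows the form is therefore given by the pivot and the errors alone, so that its positive
definiteness bounds the pivot below. The norm of column `i` of the partial factor is not known in
advance; it is bounded in the course of the same estimate. -/
lemma sum_sq_partial_factor_lt (a R : Matrix (Fin n) (Fin n) ℝ) (i : Fin n) {θ B s : ℝ}
    (hquad : ∀ x : Fin n → ℝ, s * ∑ j, x j ^ 2 ≤ ∑ j, ∑ l, x j * x l * a j l)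
    (htri : ∀ k j, j < k → R k j = 0) (hzero : ∀ k j, i ≤ k → R k j = 0)
    (hdiag : ∀ k < i, R k k ≠ 0)
    (herr : ∀ j l, j ≤ i → l ≤ i → (j < i ∨ l < i) →
      |a j l - ∑ k, R k j * R k l| ≤ θ * (√(∑ k, R k j ^ 2) * √(∑ k, R k l ^ 2)))
    (hC : ∀ j < i, ∑ k, R k j ^ 2 ≤ B) (hθ : 0 ≤ θ) (hθ1 : θ < 1) (hB : 0 ≤ B)
    (hs : 2 * θ * n * B < s) (hai : a i i ≤ (1 - θ) * B) :
    (1 + θ) * ∑ k, R k i ^ 2 < a i i := by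
  obtain ⟨x, hxi, hx0, hRx⟩ := exists_kernel_of_partial_factor R i htri hdiag
  set c : Fin n → ℝ := fun j => √(∑ k, R k j ^ 2) with hc
  have hc0 : ∀ j, 0 ≤ c j := fun j => Real.sqrt_nonneg _
  have hc2 : ∀ j, c j ^ 2 = ∑ k, R k j ^ 2 := fun j =>
    Real.sq_sqrt (sum_nonneg fun k _ => sq_nonneg _)
  set p := a i i - (1 + θ) * c i ^ 2 with hp
  have hM : ∑ j, ∑ l, x j * x l * ∑ k, R k j * R k l = 0 := by
    rw [← sum_sq_mulVec_eq]
    refine sum_eq_zero fun k _ => ?_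
    rcases lt_or_ge k i with hk | hk
    · rw [hRx k hk]; simp
    · simp [mulVec, dotProduct, hzero k _ hk]
  have hterm : ∀ j l, x j * x l * (a j l - ∑ k, R k j * R k l) ≤
      θ * ((|x j| * c j) * (|x l| * c l)) + if j = i then if l = i then p else 0 else 0 := by
    intro j l
    rcases lt_or_ge i j with hj | hj
    · simp [hx0 j hj, hj.ne']
    rcases lt_or_ge i l with hl | hl
    · simp [hx0 l hl, hl.ne']
    by_cases hjl : j < i ∨ l < i
    · have h1 := herr j l hj hl hjl
      have h2 : (if j = i then if l = i then p else 0 else 0) = 0 := by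
        rcases hjl with h | h <;> simp [h.ne]
      rw [h2, add_zero]
      calc _ ≤ |x j * x l * (a j l - ∑ k, R k j * R k l)| := le_abs_self _
        _ ≤ |x j| * |x l| * (θ * (c j * c l)) := by
            rw [abs_mul, abs_mul]
            gcongr
        _ = _ := by ring
    · obtain ⟨h1, h2⟩ := not_or.1 hjl
      obtain rfl := le_antisymm hj (not_lt.1 h1)
      obtain rfl := le_antisymm hl (not_lt.1 h2)
      have h3 : ∑ k, R k l * R k l = c l ^ 2 := by rw [hc2]; simp only [sq]
      simp only [hxi, if_true, abs_one, h3, hp]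
      linarith
  have hmain : s * ∑ j, x j ^ 2 ≤ θ * (∑ j, |x j| * c j) ^ 2 + p := by
    refine (hquad x).trans ?_
    calc ∑ j, ∑ l, x j * x l * a j l
        = ∑ j, ∑ l, x j * x l * (a j l - ∑ k, R k j * R k l) := by
          simp only [mul_sub, sum_sub_distrib, hM, sub_zero]
      _ ≤ ∑ j, ∑ l, (θ * ((|x j| * c j) * (|x l| * c l)) +
            if j = i then if l = i then p else 0 else 0) :=
          sum_le_sum fun j _ => sum_le_sum fun l _ => hterm j l
      _ = _ := by
          simp only [sum_add_distrib, ← mul_sum, sq, sum_mul_sum]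
          simp
  rw [← add_sum_erase univ (fun j => x j ^ 2) (mem_univ i),
    ← add_sum_erase univ (fun j => |x j| * c j) (mem_univ i), hxi, abs_one] at hmain
  set Y := ∑ j ∈ univ.erase i, x j ^ 2 with hY
  set z := ∑ j ∈ univ.erase i, |x j| * c j with hz
  have hY0 : 0 ≤ Y := sum_nonneg fun _ _ => sq_nonneg _
  have hz2 : z ^ 2 ≤ n * (B * Y) := by
    refine sq_sum_le_card_mul_sum_sq.trans ?_
    have h1 : (#(univ.erase i) : ℝ) ≤ n := by
      exact_mod_cast (card_le_univ _).trans_eq (Fintype.card_fin n)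
    have h2 : ∑ j ∈ univ.erase i, (|x j| * c j) ^ 2 ≤ B * Y := by
      rw [hY, mul_sum]
      refine sum_le_sum fun j hj => ?_
      rw [mul_pow, sq_abs, mul_comm]
      rcases lt_or_gt_of_ne (ne_of_mem_erase hj) with h | h
      · rw [hc2]
        gcongr
        exact hC j h
      · simp [hx0 j h]
    gcongr
  have h1 : θ * (1 * c i + z) ^ 2 ≤ θ * (2 * c i ^ 2 + 2 * (n * (B * Y))) := by
    gcongr
    nlinarith [sq_nonneg (c i - z)]
  have h2 : 0 ≤ (s - 2 * θ * n * B) * Y := mul_nonneg (by linarith) hY0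
  have h3 : s ≤ p + 2 * θ * c i ^ 2 := by nlinarith
  have hn : (1 : ℝ) ≤ n := by exact_mod_cast Nat.one_le_of_lt i.2
  have h4 : 2 * θ * B ≤ 2 * θ * n * B := by
    have : 0 ≤ θ * B := by positivity
    nlinarith
  have h5 : c i ^ 2 ≤ B := by
    have h6 : (1 - θ) * c i ^ 2 ≤ (1 - θ) * B := by
      have : 0 ≤ θ * B := by positivity
      linarith
    exact le_of_mul_le_mul_left h6 (by linarith)
  have h7 : 2 * θ * c i ^ 2 ≤ 2 * θ * B := by gcongr
  rw [← hc2]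
  linarith

open scoped Matrix.Norms.L2Operator in
/-- The spectral norm of a symmetric matrix is bounded by any bound for its quadratic form. -/
lemma norm2_le_of_quadForm_le {S : Matrix (Fin n) (Fin n) ℝ} (hS : S.IsSymm) {c : ℝ} (hc : 0 ≤ c)
    (h : ∀ x : Fin n → ℝ, |x ⬝ᵥ S *ᵥ x| ≤ c * ∑ j, x j ^ 2) : norm2 S ≤ c := by
  change ‖S‖ ≤ c
  rw [cstar_norm_def]
  set L := toEuclideanCLM (n := Fin n) (𝕜 := ℝ) S with hL
  have hsymm : (L : EuclideanSpace ℝ (Fin n) →ₗ[ℝ] EuclideanSpace ℝ (Fin n)).IsSymmetric := by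
    rw [hL, coe_toEuclideanCLM_eq_toEuclideanLin, isSymmetric_toEuclideanLin_iff]
    exact (conjTranspose_eq_transpose_of_trivial S).trans hS
  rw [L.norm_eq_iSup_rayleighQuotient hsymm]
  refine ciSup_le fun x => ?_
  rw [ContinuousLinearMap.rayleighQuotient, ContinuousLinearMap.reApplyInnerSelf_apply, abs_div,
    abs_sq]
  refine div_le_of_le_mul₀ (sq_nonneg _) hc ?_
  rw [EuclideanSpace.norm_sq_eq]
  have h1 := h x.ofLp
  rw [← inner_toEuclideanCLM, ← hL, real_inner_comm] at h1
  simpa using h1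

end SCholQR

/-! ### Backward errors of the computed Cholesky factorization and of substitution -/

namespace SCholQR

open Finset Matrix

variable {m n : ℕ}

lemma sum_eq_add_sum_lt {f : Fin n → ℝ} {i : Fin n} (hf : ∀ k, i < k → f k = 0) :
    ∑ k, f k = f i + ∑ k : {k : Fin n // k < i}, f k := by
  rw [← sum_subtype (univ.filter (· < i)) (by simp) f]
  rw [← add_sum_erase univ f (mem_univ i)]
  congr 1
  symm
  refine sum_subset (fun k hk => ?_) fun k hk hk' => hf k ?_
  · simp only [mem_filter] at hk
    simp [hk.2.ne]
  · simp only [mem_filter, mem_univ, true_and, not_lt] at hk'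
    exact lt_of_le_of_ne hk' (ne_of_mem_erase hk).symm

/-- A sum over `k ≤ i` with relative errors `θ`, compared with the exact sum. -/
lemma abs_sub_sum_le {f : Fin n → ℝ} {i : Fin n} (hf : ∀ k, i < k → f k = 0) {x Θ : ℝ}
    {θ : Option {k : Fin n // k < i} → ℝ} (hθ : ∀ o, |θ o| ≤ Θ)
    (hx : x = f i * (1 + θ none) + ∑ k : {k : Fin n // k < i}, f k * (1 + θ (some k))) :
    |x - ∑ k, f k| ≤ Θ * ∑ k, |f k| := by
  rw [sum_eq_add_sum_lt hf, sum_eq_add_sum_lt (f := fun k => |f k|) fun k hk => by simp [hf k hk],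
    hx]
  have h1 : f i * (1 + θ none) + ∑ k : {k : Fin n // k < i}, f k * (1 + θ (some k)) -
      (f i + ∑ k : {k : Fin n // k < i}, f k) =
      f i * θ none + ∑ k : {k : Fin n // k < i}, f k * θ (some k) := by
    simp only [mul_add, mul_one, sum_add_distrib]
    ring
  rw [h1, mul_add, mul_sum]
  refine (abs_add_le _ _).trans (add_le_add ?_ ((abs_sum_le_sum_abs _ _).trans
    (sum_le_sum fun k _ => ?_)))
  · rw [abs_mul, mul_comm]
    gcongr
    exact hθ _
  · rw [abs_mul, mul_comm]
    gcongr
    exact hθ _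

lemma cholRow_eq_zero (A : Matrix (Fin n) (Fin n) ℝ) (ord : EvalOrder m n) (δ : Op m n → ℝ)
    {k j : Fin n} (h : j < k) : cholRow A ord δ k j = 0 := by
  rw [cholRow, if_neg h.ne, if_neg h.not_gt]

lemma cholRow_self (A : Matrix (Fin n) (Fin n) ℝ) (ord : EvalOrder m n) (δ : Op m n → ℝ)
    (i : Fin n) : cholRow A ord δ i i = √(cholPivot A ord δ i) * (1 + δ (.cholSqrt i)) := by
  rw [cholRow, if_pos rfl, cholPivot]

lemma cholRow_of_lt (A : Matrix (Fin n) (Fin n) ℝ) (ord : EvalOrder m n) (δ : Op m n → ℝ)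
    {i j : Fin n} (h : i < j) : cholRow A ord δ i j =
      cholSum A ord δ i j (fun k => cholRow A ord δ k.1) / cholRow A ord δ i i *
        (1 + δ (.cholDiv i j)) := by
  rw [cholRow_self, cholPivot, cholRow, if_neg h.ne', if_pos h]

/-- The symmetric matrix with the same upper triangle as `A`. -/
def symmUpper (A : Matrix (Fin n) (Fin n) ℝ) : Matrix (Fin n) (Fin n) ℝ :=
  fun j l => if j ≤ l then A j l else A l j

section Cholesky

variable {A : Matrix (Fin n) (Fin n) ℝ} {ord : EvalOrder m n} {δ : Op m n → ℝ} {u lam : ℝ}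

/-- The computed sum in the Cholesky factorization recovers the entry of the matrix. -/
lemma SmallDeviations.exists_cholSum_eq (hδ : SmallDeviations ord lam u δ) (hlam : 0 ≤ lam)
    (hb : ∀ o, |δ o| ≤ u) (hu : u ≤ 1 / 2) (hX : lam * √(n + 1) * u ≤ 1 / 2200)
    (hK : (n + 1) * u ^ 2 ≤ lam * √(n + 1) * u / 2200) (i j : Fin n) :
    ∃ θ : Option {k : Fin n // k < i} → ℝ,
      (∀ o, |θ o| ≤ (4 + 1 / 100) * (lam * √(n + 1) * u)) ∧
      A i j = cholSum A ord δ i j (fun k => cholRow A ord δ k.1) *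
          (1 + δ (cholOp i j none)) ^ cholExp i j none * (1 + θ none) +
        ∑ k : {k : Fin n // k < i}, cholRow A ord δ k i * cholRow A ord δ k j *
          (1 + θ (some k)) := by
  have hu0 : 0 ≤ u := (abs_nonneg _).trans (hb (.shiftAdd i))
  have hcard := card_option_lt_le i
  rw [Fintype.card_option] at hcard
  have hexp : 1 ≤ cholExp i j none ∧ cholExp i j none ≤ 2 := by
    simp only [cholExp]; split_ifs <;> simp
  refine (ord.chol_complete i j).exists_eq_eval_add_sum (u := u)
    (fun o => match o with
      | none => A i j
      | some k => -(cholRow A ord δ k i * cholRow A ord δ k j * (1 + δ (.cholMul i j k))))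
    (fun k => cholRow A ord δ k i * cholRow A ord δ k j) (fun k => δ (.cholMul i j k))
    (δ (cholOp i j none)) hexp.1 (fun a => δ (.cholAdd i j a)) (fun k => rfl) hu
    (fun k => hb _) (hb _) (fun a => hb _) (hδ.chol i j none) (fun k => ?_) ?_ (by norm_num)
    (by positivity) hX
  · simpa only [cholExp, cholOp, Nat.cast_one] using hδ.chol i j (some k)
  · refine le_trans (mul_le_mul_of_nonneg_right ?_ (sq_nonneg u)) hK
    have : Fintype.card {k : Fin n // k < i} + cholExp i j none ≤ n + 1 := by omega
    exact_mod_cast this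

lemma cholRow_self_pos (hb : ∀ o, |δ o| ≤ u) (hu : u ≤ 1 / 2) {i : Fin n}
    (hi : 0 < cholPivot A ord δ i) : 0 < cholRow A ord δ i i := by
  rw [cholRow_self]
  exact mul_pos (Real.sqrt_pos.2 hi) (one_add_pos hu (hb _))

/-- Backward error of row `i` of the computed Cholesky factor. -/
lemma SmallDeviations.abs_sub_sum_cholRow_le (hδ : SmallDeviations ord lam u δ) (hlam : 0 ≤ lam)
    (hb : ∀ o, |δ o| ≤ u) (hu : u ≤ 1 / 2) (hX : lam * √(n + 1) * u ≤ 1 / 2200)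
    (hK : (n + 1) * u ^ 2 ≤ lam * √(n + 1) * u / 2200) {i j : Fin n} (hij : i ≤ j)
    (hi : 0 < cholPivot A ord δ i) :
    |A i j - ∑ k, cholRow A ord δ k i * cholRow A ord δ k j| ≤
      (4 + 1 / 100) * (lam * √(n + 1) * u) *
        ∑ k, |cholRow A ord δ k i * cholRow A ord δ k j| := by
  obtain ⟨θ, hθ, hA⟩ := hδ.exists_cholSum_eq (A := A) hlam hb hu hX hK i j
  refine abs_sub_sum_le (fun k hk => by rw [cholRow_eq_zero _ _ _ hk, zero_mul]) hθ ?_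
  rw [hA]
  congr 2
  rcases hij.eq_or_lt with rfl | hlt
  · simp only [cholOp, cholExp, if_true]
    rw [cholRow_self, ← cholPivot, mul_mul_mul_comm, Real.mul_self_sqrt hi.le, sq]
  · simp only [cholOp, cholExp, if_neg hlt.ne, pow_one]
    have := (cholRow_self_pos hb hu hi).ne'
    rw [cholRow_of_lt _ _ _ hlt]
    field_simp

lemma sum_abs_mul_le {ι : Type*} [Fintype ι] (f g : ι → ℝ) :
    ∑ k, |f k * g k| ≤ √(∑ k, f k ^ 2) * √(∑ k, g k ^ 2) := by
  have := Real.sum_mul_le_sqrt_mul_sqrt univ (fun k => |f k|) (fun k => |g k|)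
  simpa only [abs_mul, sq_abs] using this

lemma SmallDeviations.one_sub_mul_sum_sq_cholRow_le (hδ : SmallDeviations ord lam u δ)
    (hlam : 0 ≤ lam) (hb : ∀ o, |δ o| ≤ u) (hu : u ≤ 1 / 2) (hX : lam * √(n + 1) * u ≤ 1 / 2200)
    (hK : (n + 1) * u ^ 2 ≤ lam * √(n + 1) * u / 2200) {j : Fin n}
    (hj : 0 < cholPivot A ord δ j) :
    (1 - (4 + 1 / 100) * (lam * √(n + 1) * u)) * ∑ k, cholRow A ord δ k j ^ 2 ≤ A j j := by
  have h := hδ.abs_sub_sum_cholRow_le hlam hb hu hX hK le_rfl hj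
  simp only [abs_mul_self] at h
  simp only [sq]
  linarith [(abs_le.1 h).1]

/-- The computed Cholesky factorization of a matrix whose upper triangle is that of a sufficiently
positive definite form runs to completion. -/
lemma SmallDeviations.cholPivot_pos (hδ : SmallDeviations ord lam u δ) (hlam : 0 ≤ lam)
    (hb : ∀ o, |δ o| ≤ u) (hu : u ≤ 1 / 2) (hX : lam * √(n + 1) * u ≤ 1 / 2200)
    (hK : (n + 1) * u ^ 2 ≤ lam * √(n + 1) * u / 2200) {s B : ℝ} (hB : 0 ≤ B)
    (hquad : ∀ x : Fin n → ℝ, s * ∑ j, x j ^ 2 ≤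
      ∑ j, ∑ l, x j * x l * symmUpper A j l)
    (hs : 2 * ((4 + 1 / 100) * (lam * √(n + 1) * u)) * n * B < s)
    (hA : ∀ j, A j j ≤ (1 - (4 + 1 / 100) * (lam * √(n + 1) * u)) * B) (i : Fin n) :
    0 < cholPivot A ord δ i := by
  have hu0 : 0 ≤ u := (abs_nonneg _).trans (hb (.shiftAdd i))
  have hX0 : 0 ≤ lam * √(n + 1) * u := by positivity
  induction i using WellFoundedLT.induction with
  | ind i ih =>
  set R : Matrix (Fin n) (Fin n) ℝ := fun k j => if k < i then cholRow A ord δ k j else 0 with hR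
  -- Below column `i` the truncation to the rows above `i` loses nothing.
  have hRmul : ∀ j < i, ∀ l, ∀ k, R k j * R k l = cholRow A ord δ k j * cholRow A ord δ k l := by
    intro j hj l k
    simp only [hR]
    split_ifs with hk
    · rfl
    · rw [cholRow_eq_zero _ _ _ (hj.trans_le (not_lt.1 hk)), zero_mul, zero_mul]
  have herr : ∀ j l, j < i → j ≤ l → |A j l - ∑ k, R k j * R k l| ≤
      (4 + 1 / 100) * (lam * √(n + 1) * u) * (√(∑ k, R k j ^ 2) * √(∑ k, R k l ^ 2)) := by
    intro j l hj hjl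
    have h1 := hδ.abs_sub_sum_cholRow_le hlam hb hu hX hK hjl (ih j hj)
    simp only [← hRmul j hj] at h1
    refine h1.trans ?_
    gcongr
    exact sum_abs_mul_le _ _
  have hlt := sum_sq_partial_factor_lt (symmUpper A) R i
    (θ := (4 + 1 / 100) * (lam * √(n + 1) * u)) (B := B) (s := s) hquad
    (fun k j hjk => by simp [hR, cholRow_eq_zero A ord δ hjk])
    (fun k j hk => by simp [hR, hk.not_gt])
    (fun k hk => by simpa [hR, hk] using (cholRow_self_pos hb hu (ih k hk)).ne')
    (fun j l hj hl hjl => by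
      rcases le_total j l with h | h
      · have hj' : j < i := by
          rcases hjl with h' | h'
          · exact h'
          · exact h.trans_lt h'
        simpa only [symmUpper, if_pos h] using herr j l hj' h
      · have hl' : l < i := by
          rcases hjl with h' | h'
          · exact h.trans_lt h'
          · exact h'
        have h1 := herr l j hl' h
        have h2 : symmUpper A j l = A l j := by
          unfold symmUpper
          split_ifs with h3
          · rw [le_antisymm h3 h]
          · rfl
        simp only [h2]
        rw [mul_comm (√(∑ k, R k j ^ 2))]
        simpa only [mul_comm (R _ l)] using h1)
    (fun j hj => by
      have h1 := hδ.one_sub_mul_sum_sq_cholRow_le hlam hb hu hX hK (ih j hj)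
      have h2 : ∑ k, R k j ^ 2 = ∑ k, cholRow A ord δ k j ^ 2 := by
        simp only [sq, hRmul j hj]
      rw [h2]
      exact le_of_mul_le_mul_left (h1.trans (hA j)) (by linarith))
    (by positivity) (by linarith) hB hs (by simpa [symmUpper] using hA i)
  simp only [symmUpper, le_refl, if_true] at hlt
  obtain ⟨θ, hθ, hAi⟩ := hδ.exists_cholSum_eq (A := A) hlam hb hu hX hK i i
  rw [← cholPivot] at hAi
  have hsum : ∑ k : {k : Fin n // k < i}, cholRow A ord δ k i * cholRow A ord δ k i *
      (1 + θ (some k)) ≤ (1 + (4 + 1 / 100) * (lam * √(n + 1) * u)) * ∑ k, R k i ^ 2 := by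
    rw [sum_eq_add_sum_lt (f := fun k => R k i ^ 2) (i := i) fun k hk => by simp [hR, hk.not_gt],
      mul_add, mul_sum]
    have h0 : R i i = 0 := by simp [hR]
    rw [h0, zero_pow two_ne_zero, mul_zero, zero_add]
    refine sum_le_sum fun k _ => ?_
    have hk : R k i = cholRow A ord δ k i := by simp [hR, k.2]
    rw [hk, ← sq, mul_comm]
    gcongr
    exact (le_abs_self _).trans (hθ _)
  have hpos : 0 < cholPivot A ord δ i * ((1 + δ (cholOp i i none)) ^ cholExp i i none *
      (1 + θ none)) := by
    linarith
  refine pos_of_mul_pos_left hpos (mul_nonneg (pow_nonneg ?_ _) ?_)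
  · exact (one_add_pos hu (hb _)).le
  · linarith [(abs_le.1 (hθ none)).1]

end Cholesky

/-- Backward error of the computed solution of `Q V = T`. -/
lemma SmallDeviations.abs_sub_sum_solveRow_le {ord : EvalOrder m n} {δ : Op m n → ℝ} {u lam : ℝ}
    (hδ : SmallDeviations ord lam u δ) (hlam : 0 ≤ lam) (hb : ∀ o, |δ o| ≤ u) (hu : u ≤ 1 / 2)
    (hX : lam * √n * u ≤ 1 / 2200) (hK : n * u ^ 2 ≤ lam * √n * u / 2200)
    {V : Matrix (Fin n) (Fin n) ℝ} (T : Matrix (Fin m) (Fin n) ℝ)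
    (htri : ∀ k j, j < k → V k j = 0) (hdiag : ∀ j, V j j ≠ 0) (r : Fin m) (j : Fin n) :
    |T r j - ∑ k, solveRow V T ord δ r k * V k j| ≤
      (3 / 2 + 1 / 100) * (lam * √n * u) * ∑ k, |solveRow V T ord δ r k * V k j| := by
  have hu0 : 0 ≤ u := (abs_nonneg _).trans (hb (.shiftAdd j))
  have hcard := card_option_lt_le j
  rw [Fintype.card_option] at hcard
  obtain ⟨θ, hθ, hT⟩ := (ord.solve_complete r j).exists_eq_eval_add_sum (u := u)
    (fun o => match o with
      | none => T r j
      | some k => -(solveRow V T ord δ r k.1 * V k.1 j * (1 + δ (.solveMul r j k.1))))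
    (fun k => solveRow V T ord δ r k.1 * V k.1 j) (fun k => δ (.solveMul r j k.1))
    (δ (.solveDiv r j)) le_rfl (fun a => δ (.solveAdd r j a)) (fun k => rfl) hu
    (fun k => hb _) (hb _) (fun a => hb _) (by simpa using! hδ.solve r j none)
    (fun k => hδ.solve r j (some k)) (by
      refine le_trans ?_ hK
      gcongr
      exact_mod_cast hcard) (by norm_num) (by positivity) hX
  refine abs_sub_sum_le (fun k hk => by rw [htri _ _ hk, mul_zero]) hθ ?_
  dsimp only at hT
  rw [hT]
  congr 2
  have h1 := hdiag j
  conv_rhs => rw [solveRow]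
  rw [pow_one, mul_right_comm, div_mul_cancel₀ _ h1]

end SCholQR

/-! ### Orthogonality and residual of the computed factors -/

namespace SCholQR

open Finset Matrix

variable {m n : ℕ}

lemma sum_sq_le_normG_sq (T : Matrix (Fin m) (Fin n) ℝ) (j : Fin n) :
    ∑ i, T i j ^ 2 ≤ normG T ^ 2 := by
  have h : √(∑ i, T i j ^ 2) ≤ normG T :=
    le_ciSup (f := fun j => √(∑ i, T i j ^ 2)) (Set.finite_range _).bddAbove j
  exact (Real.sqrt_le_left ((Real.sqrt_nonneg _).trans h)).1 h

lemma normG_pos {T : Matrix (Fin m) (Fin n) ℝ} (hT : T ≠ 0) : 0 < normG T := by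
  obtain ⟨i, j, hij⟩ : ∃ i j, T i j ≠ 0 := by
    by_contra! h
    exact hT (Matrix.ext h)
  have h0 : 0 ≤ normG T := Real.iSup_nonneg fun _ => Real.sqrt_nonneg _
  refine h0.lt_of_ne fun h => ?_
  have h1 := sum_sq_le_normG_sq T j
  have h2 : T i j ^ 2 ≤ ∑ i, T i j ^ 2 :=
    single_le_sum (f := fun i => T i j ^ 2) (fun _ _ => sq_nonneg _) (mem_univ i)
  rw [← h, zero_pow two_ne_zero] at h1
  have := pow_pos (abs_pos.2 hij) 2
  rw [sq_abs] at this
  linarith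

open scoped Matrix.Norms.L2Operator in
lemma norm2_ne_zero {T : Matrix (Fin m) (Fin n) ℝ} (hT : T ≠ 0) : norm2 T ≠ 0 := by
  change ‖T‖ ≠ 0
  exact norm_ne_zero_iff.2 hT

lemma SmallDeviations.abs_gram_sub_le {ord : EvalOrder m n} {δ : Op m n → ℝ} {u lam : ℝ}
    (hδ : SmallDeviations ord lam u δ) (hlam : 0 ≤ lam) (hb : ∀ o, |δ o| ≤ u) (hu : u ≤ 1 / 2)
    (hX : lam * √m * u ≤ 1 / 2200) (hK : m * u ^ 2 ≤ lam * √m * u / 2200)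
    (T : Matrix (Fin m) (Fin n) ℝ) (i j : Fin n) :
    |SCholQR.gram T ord δ i j - ∑ k, T k i * T k j| ≤
      (3 + 1 / 100) * (lam * √m * u) * normG T ^ 2 := by
  have hu0 : 0 ≤ u := (abs_nonneg _).trans (hb (.shiftAdd j))
  obtain ⟨θ, hθ, h⟩ := (ord.gram_complete i j).exists_eval_eq (u := u) (c := 3)
    (fun k => T k i * T k j) (fun k => δ (.gramMul i j k)) (fun a => δ (.gramAdd i j a)) hu
    (fun k => hb _) (fun a => hb _) (hδ.gram i j) (by simpa using hK) (by norm_num)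
    (by positivity) hX
  rw [SCholQR.gram, h, ← sum_sub_distrib]
  have h1 : ∑ k, |T k i * T k j| ≤ normG T ^ 2 := by
    refine (sum_abs_mul_le _ _).trans ?_
    have h0 : 0 ≤ normG T := Real.iSup_nonneg fun _ => Real.sqrt_nonneg _
    rw [sq]
    gcongr <;> exact (Real.sqrt_le_left h0).2 (sum_sq_le_normG_sq T _)
  calc _ ≤ ∑ k, |T k i * T k j * (1 + θ k) - T k i * T k j| := abs_sum_le_sum_abs _ _
    _ ≤ ∑ k, (3 + 1 / 100) * (lam * √m * u) * |T k i * T k j| := by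
        refine sum_le_sum fun k _ => ?_
        rw [show T k i * T k j * (1 + θ k) - T k i * T k j = θ k * (T k i * T k j) by ring, abs_mul]
        gcongr
        exact hθ k
    _ ≤ _ := by
        rw [← mul_sum]
        gcongr

lemma quadForm_add_diagonal (A E : Matrix (Fin n) (Fin n) ℝ) (T : Matrix (Fin m) (Fin n) ℝ) (s : ℝ)
    (hA : ∀ j l, A j l = ∑ r, T r j * T r l + (if j = l then s else 0) + E j l) (x : Fin n → ℝ) :
    ∑ j, ∑ l, x j * x l * A j l =
      ∑ r, (T *ᵥ x) r ^ 2 + s * ∑ j, x j ^ 2 + ∑ j, ∑ l, x j * x l * E j l := by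
  simp only [hA, mul_add, sum_add_distrib]
  rw [← sum_sq_mulVec_eq]
  congr 2
  simp [mul_sum, sq, mul_comm]

lemma abs_symmUpper_sub_le {A B : Matrix (Fin n) (Fin n) ℝ} (hB : ∀ j l, B j l = B l j) {e : ℝ}
    (h : ∀ j l, j ≤ l → |A j l - B j l| ≤ e) (j l : Fin n) : |symmUpper A j l - B j l| ≤ e := by
  unfold symmUpper
  split_ifs with h1
  · exact h j l h1
  · rw [hB]
    exact h l j (le_of_not_ge h1)

/-- A matrix whose upper triangle is close to that of `TᵀT + s I` is positive definite. -/
lemma le_quadForm_symmUpper {A : Matrix (Fin n) (Fin n) ℝ} {T : Matrix (Fin m) (Fin n) ℝ} {s e : ℝ}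
    (hA : ∀ j l, j ≤ l → |A j l - (∑ r, T r j * T r l + if j = l then s else 0)| ≤ e)
    (x : Fin n → ℝ) :
    ∑ r, (T *ᵥ x) r ^ 2 + (s - n * e) * ∑ j, x j ^ 2 ≤
      ∑ j, ∑ l, x j * x l * symmUpper A j l := by
  set E : Matrix (Fin n) (Fin n) ℝ :=
    fun j l => symmUpper A j l - (∑ r, T r j * T r l + if j = l then s else 0) with hE
  rw [quadForm_add_diagonal (symmUpper A) E T s (fun j l => by simp only [hE]; ring)]
  have h1 := (abs_le.1 (abs_quadForm_le (E := E) (fun j l => abs_symmUpper_sub_le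
    (fun j l => by simp only [mul_comm, eq_comm]) hA j l) x)).1
  linarith

/-- The computed factor `V` dominates `T` and a multiple of the identity. -/
lemma sum_sq_mulVec_add_le {A V : Matrix (Fin n) (Fin n) ℝ} {T : Matrix (Fin m) (Fin n) ℝ}
    {s e f t : ℝ}
    (hA : ∀ j l, j ≤ l → |A j l - (∑ r, T r j * T r l + if j = l then s else 0)| ≤ e)
    (hV : ∀ j l, j ≤ l → |A j l - ∑ k, V k j * V k l| ≤ f) (ht : n * e + n * f ≤ s - t)
    (x : Fin n → ℝ) :
    ∑ r, (T *ᵥ x) r ^ 2 + t * ∑ j, x j ^ 2 ≤ ∑ k, (V *ᵥ x) k ^ 2 := by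
  have h1 := le_quadForm_symmUpper hA x
  have h2 := (abs_le.1 (abs_quadForm_le (E := fun j l => symmUpper A j l - ∑ k, V k j * V k l)
    (abs_symmUpper_sub_le (fun j l => by simp only [mul_comm]) hV) x)).2
  simp only [mul_sub, sum_sub_distrib] at h2
  rw [← sum_sq_mulVec_eq] at h2
  have h3 : (n * e + n * f) * ∑ j, x j ^ 2 ≤ (s - t) * ∑ j, x j ^ 2 :=
    mul_le_mul_of_nonneg_right ht (sum_nonneg fun _ _ => sq_nonneg _)
  linarith

lemma SmallDeviations.abs_gramShifted_sub_le {ord : EvalOrder m n} {δ : Op m n → ℝ} {u lam : ℝ}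
    (hδ : SmallDeviations ord lam u δ) (hlam : 0 ≤ lam) (hb : ∀ o, |δ o| ≤ u) (hu : u ≤ 1 / 2)
    (hX : lam * √m * u ≤ 1 / 2200) (hK : m * u ^ 2 ≤ lam * √m * u / 2200)
    {T : Matrix (Fin m) (Fin n) ℝ} {s : ℝ} (hs : 0 ≤ s) (hsg : s ≤ 0.01 * normG T ^ 2)
    (j l : Fin n) :
    |gramShifted T s ord δ j l - (∑ r, T r j * T r l + if j = l then s else 0)| ≤
      (3.01 * (lam * √m * u) + 1.02 * u) * normG T ^ 2 := by
  have hu0 : 0 ≤ u := (abs_nonneg _).trans (hb (.shiftAdd j))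
  have h1 := hδ.abs_gram_sub_le hlam hb hu hX hK T j l
  have h0 : 0 ≤ u * normG T ^ 2 := by positivity
  rw [gramShifted, shifted]
  split_ifs with hjl
  · subst hjl
    have h2 : ∑ r, T r j * T r j ≤ normG T ^ 2 := by
      simpa only [sq] using sum_sq_le_normG_sq T j
    have h3 : 0 ≤ ∑ r, T r j * T r j := sum_nonneg fun _ _ => mul_self_nonneg _
    have h4 := abs_le.1 h1
    have h6 : (3 + 1 / 100) * (lam * √m * u) * normG T ^ 2 ≤ 0.01 * normG T ^ 2 := by
      gcongr; linarith
    have h5 : |SCholQR.gram T ord δ j j + s| ≤ 1.02 * normG T ^ 2 := by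
      rw [abs_le]
      constructor <;> linarith
    have h7 : |(SCholQR.gram T ord δ j j + s) * δ (.shiftAdd j)| ≤ 1.02 * normG T ^ 2 * u := by
      rw [abs_mul]
      gcongr
      exact hb _
    rw [show (SCholQR.gram T ord δ j j + s) * (1 + δ (.shiftAdd j)) - (∑ r, T r j * T r j + s) =
      (SCholQR.gram T ord δ j j - ∑ r, T r j * T r j) +
        (SCholQR.gram T ord δ j j + s) * δ (.shiftAdd j) by ring]
    refine (abs_add_le _ _).trans ?_
    linarith
  · rw [add_zero]
    linarith

/-- If the factor `V` dominates both `T` and a multiple of the identity, then a computed solution `Q`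
of `Q V = T` with small backward error is nearly a contraction, and its residual is as small as the
backward error suggests. -/
lemma sum_sq_residual_le_and_sum_sq_mulVec_le {T Q : Matrix (Fin m) (Fin n) ℝ}
    {V : Matrix (Fin n) (Fin n) ℝ} {s g X : ℝ} (hs : 0 < s) (hg : 0 < g)
    (hX : 0 ≤ X) (hnX : n * X ≤ 1 / 2200) (hsX : 11 * (n * X) * g ^ 2 ≤ s)
    (hV : ∀ x : Fin n → ℝ, ∑ r, (T *ᵥ x) r ^ 2 + s / 2 * ∑ j, x j ^ 2 ≤ ∑ k, (V *ᵥ x) k ^ 2)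
    (hcol : ∀ j, ∑ k, V k j ^ 2 ≤ 1.03 * g ^ 2)
    (hsolve : ∀ r j, |T r j - ∑ k, Q r k * V k j| ≤
      (3 / 2 + 1 / 100) * X * ∑ k, |Q r k * V k j|) :
    ∑ r, ∑ j, (Q * V - T) r j ^ 2 ≤ (1.67 * (n * X) * g) ^ 2 ∧
      ∀ x : Fin n → ℝ, ∑ r, (Q *ᵥ x) r ^ 2 ≤ 2 * ∑ j, x j ^ 2 := by
  set D := Q * V - T with hD
  set F := ∑ r, ∑ j, D r j ^ 2 with hF
  have hF0 : 0 ≤ F := sum_nonneg fun _ _ => sum_nonneg fun _ _ => sq_nonneg _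
  have hdet : IsUnit V.det := by
    rw [isUnit_iff_ne_zero]
    intro h0
    obtain ⟨x, hx0, hx⟩ := exists_mulVec_eq_zero_iff.2 h0
    have h1 := hV x
    have h2 : 0 ≤ ∑ r, (T *ᵥ x) r ^ 2 := sum_nonneg fun _ _ => sq_nonneg _
    have h3 : 0 < ∑ j, x j ^ 2 := by
      obtain ⟨j, hj⟩ := Function.ne_iff.1 hx0
      exact sum_pos' (fun _ _ => sq_nonneg _) ⟨j, mem_univ j, by
        have : x j ≠ 0 := hj
        positivity⟩
    have h4 : 0 < s / 2 * ∑ j, x j ^ 2 := by positivity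
    simp only [hx, Pi.zero_apply, zero_pow two_ne_zero, sum_const_zero] at h1
    linarith
  -- With `x = V y`, the vector `Q x` is `T y` plus a perturbation of relative size `√F`.
  have hQ : ∀ x : Fin n → ℝ, ∑ r, (Q *ᵥ x) r ^ 2 ≤ (1.05 + 42 * (F / s)) * ∑ j, x j ^ 2 := by
    intro x
    set y := V⁻¹ *ᵥ x with hy
    have hVy : V *ᵥ y = x := by
      rw [hy, mulVec_mulVec, mul_nonsing_inv _ hdet, one_mulVec]
    have hQx : ∀ r, (Q *ᵥ x) r = (T *ᵥ y) r + (D *ᵥ y) r := by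
      intro r
      rw [← hVy, hD, sub_mulVec, Pi.sub_apply, mulVec_mulVec]
      ring
    have h1 := hV y
    rw [hVy] at h1
    have h2 := sum_sq_mulVec_le D y
    have h3 : ∑ r, (Q *ᵥ x) r ^ 2 ≤ 1.05 * ∑ r, (T *ᵥ y) r ^ 2 + 21 * ∑ r, (D *ᵥ y) r ^ 2 := by
      rw [mul_sum, mul_sum, ← sum_add_distrib]
      refine sum_le_sum fun r _ => ?_
      rw [hQx]
      nlinarith [sq_nonneg ((T *ᵥ y) r - 20 * (D *ᵥ y) r)]
    have h4 : 0 ≤ ∑ r, (T *ᵥ y) r ^ 2 := sum_nonneg fun _ _ => sq_nonneg _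
    have h6 : 0 ≤ ∑ j, y j ^ 2 := sum_nonneg fun _ _ => sq_nonneg _
    have h5 : ∑ j, y j ^ 2 ≤ 2 / s * ∑ j, x j ^ 2 := by
      rw [div_mul_eq_mul_div, le_div_iff₀ hs]
      linarith
    have h8 : 0 ≤ s / 2 * ∑ j, y j ^ 2 := by positivity
    have h7 : F * ∑ j, y j ^ 2 ≤ F * (2 / s * ∑ j, x j ^ 2) := by gcongr
    calc _ ≤ 1.05 * ∑ j, x j ^ 2 + 21 * (F * (2 / s * ∑ j, x j ^ 2)) := by linarith
      _ = _ := by ring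
  have hQF : ∑ r, ∑ k, Q r k ^ 2 ≤ n * (1.05 + 42 * (F / s)) := by
    rw [sum_comm]
    have h1 : ∀ k, ∑ r, Q r k ^ 2 ≤ 1.05 + 42 * (F / s) := by
      intro k
      have := hQ (Pi.single k 1)
      simpa [Pi.single_apply] using this
    have h2 := sum_le_card_nsmul univ _ _ fun k _ => h1 k
    rwa [card_univ, Fintype.card_fin, nsmul_eq_mul] at h2
  have hFQ : F ≤ ((3 / 2 + 1 / 100) * X) ^ 2 * (1.03 * g ^ 2) * n * ∑ r, ∑ k, Q r k ^ 2 := by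
    rw [hF, mul_sum]
    refine sum_le_sum fun r _ => ?_
    have h1 : ∀ j, D r j ^ 2 ≤ ((3 / 2 + 1 / 100) * X) ^ 2 * (1.03 * g ^ 2) *
        ∑ k, Q r k ^ 2 := by
      intro j
      have h2 : |D r j| ≤ (3 / 2 + 1 / 100) * X * (√(∑ k, Q r k ^ 2) * √(∑ k, V k j ^ 2)) := by
        rw [hD, Matrix.sub_apply, mul_apply, abs_sub_comm]
        refine (hsolve r j).trans ?_
        gcongr
        exact sum_abs_mul_le _ _
      have h3 := pow_le_pow_left₀ (abs_nonneg _) h2 2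
      rw [sq_abs, mul_pow, mul_pow (√_), Real.sq_sqrt (sum_nonneg fun _ _ => sq_nonneg _),
        Real.sq_sqrt (sum_nonneg fun _ _ => sq_nonneg _)] at h3
      refine h3.trans ?_
      have h4 : 0 ≤ ∑ k, Q r k ^ 2 := sum_nonneg fun _ _ => sq_nonneg _
      calc _ ≤ ((3 / 2 + 1 / 100) * X) ^ 2 * (∑ k, Q r k ^ 2 * (1.03 * g ^ 2)) := by
            rw [← sum_mul]
            gcongr
            exact hcol j
        _ = _ := by rw [← sum_mul]; ring
    have h5 := sum_le_card_nsmul univ _ _ fun j _ => h1 j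
    rw [card_univ, Fintype.card_fin, nsmul_eq_mul] at h5
    linarith
  have hY0 : 0 ≤ n * X := by positivity
  -- The estimates for `F` and `Q` combine to a linear inequality for `F` with a small coefficient.
  have hsmall : 2.2801 * 1.03 * 42 * (n * X) ^ 2 * g ^ 2 * (F / s) ≤ 0.005 * F := by
    rw [mul_div_assoc', div_le_iff₀ hs]
    have h1 : (n * X) ^ 2 * g ^ 2 * 24200 ≤ s := by
      have : (n * X) * ((n * X) * g ^ 2) ≤ 1 / 2200 * ((n * X) * g ^ 2) := by gcongr
      nlinarith
    have h2 : (n * X) ^ 2 * g ^ 2 * 24200 * F ≤ s * F := by gcongr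
    have h3 : 0 ≤ s * F := by positivity
    linarith
  have hF1 : F ≤ 2.2801 * 1.03 * (n * X) ^ 2 * g ^ 2 * (1.05 + 42 * (F / s)) := by
    refine hFQ.trans ?_
    calc _ ≤ ((3 / 2 + 1 / 100) * X) ^ 2 * (1.03 * g ^ 2) * n * (n * (1.05 + 42 * (F / s))) := by
          gcongr
      _ = _ := by ring
  have hZ : 0 ≤ (n * X) ^ 2 * g ^ 2 := by positivity
  have hF2 : F ≤ (1.67 * (n * X) * g) ^ 2 := by
    have : (1.67 * (n * X) * g) ^ 2 = 2.7889 * ((n * X) ^ 2 * g ^ 2) := by ring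
    rw [this]
    linarith
  refine ⟨hF2, fun x => (hQ x).trans ?_⟩
  have h1 : F / s ≤ 0.01 := by
    rw [div_le_iff₀ hs]
    refine hF2.trans ?_
    have : (n * X) * ((n * X) * g ^ 2) ≤ 1 / 2200 * ((n * X) * g ^ 2) := by gcongr
    have : (1.67 * (n * X) * g) ^ 2 = 2.7889 * ((n * X) * ((n * X) * g ^ 2)) := by ring
    linarith
  have h2 : 0 ≤ ∑ j, x j ^ 2 := sum_nonneg fun _ _ => sq_nonneg _
  gcongr
  linarith

lemma norm2_transpose_mul_self_sub_one_le {Q : Matrix (Fin m) (Fin n) ℝ}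
    (hQ : ∀ x : Fin n → ℝ, ∑ r, (Q *ᵥ x) r ^ 2 ≤ 2 * ∑ j, x j ^ 2) :
    norm2 (Q.transpose * Q - 1) ≤ 1 := by
  refine norm2_le_of_quadForm_le ?_ zero_le_one fun x => ?_
  · simp [IsSymm, transpose_sub, transpose_mul]
  · have h1 : x ⬝ᵥ (Q.transpose * Q - 1) *ᵥ x = ∑ r, (Q *ᵥ x) r ^ 2 - ∑ j, x j ^ 2 := by
      rw [sub_mulVec, dotProduct_sub, one_mulVec, ← mulVec_mulVec, dotProduct_mulVec,
        vecMul_transpose]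
      simp only [dotProduct, sq]
    have h2 : 0 ≤ ∑ r, (Q *ᵥ x) r ^ 2 := sum_nonneg fun _ _ => sq_nonneg _
    rw [h1, abs_le]
    constructor <;> linarith [hQ x]

lemma mul_sq_le_div {k u X c : ℝ} (hu : 0 ≤ u) (hk : k * u ≤ 1 / c) (hX : u ≤ X)
    (hc : 0 ≤ c := by norm_num) : k * u ^ 2 ≤ X / c := by
  calc k * u ^ 2 = (k * u) * u := by ring
    _ ≤ 1 / c * X := by gcongr
    _ = X / c := by ring

/-- On the event of small deviations the algorithm runs to completion, and the computed factors
have the required orthogonality and residual. -/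
theorem SmallDeviations.runsToCompletion_and_le {ord : EvalOrder m n} {δ : Op m n → ℝ} {u lam : ℝ}
    (hδ : SmallDeviations ord lam u δ) (hlam : 1 ≤ lam) (hb : ∀ o, |δ o| ≤ u) (hu : 0 < u)
    {T : Matrix (Fin m) (Fin n) ℝ} (hT : T ≠ 0) (hm1 : 1 ≤ m) (hn1 : 1 ≤ n)
    (hm : lam * √m * n * u ≤ 1 / 2200) (hm' : (m : ℝ) * n * u ≤ 1 / 2200)
    (hn : lam * √(n + 1) * n * u ≤ 1 / 2200) (hn' : (n : ℝ) * (n + 1) * u ≤ 1 / 2200) {s : ℝ}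
    (hs : s = 11 * lam * (√m * n * u + √(n + 1) * n * u) * normG T ^ 2) :
    RunsToCompletion T s ord δ ∧
      norm2 ((factorQ T s ord δ).transpose * factorQ T s ord δ - 1) ≤ 1 ∧
      normF (factorQ T s ord δ * factorV T s ord δ - T) ≤
        1.67 * (n * (lam * √n * u)) * normG T := by
  have hg := normG_pos hT
  set g := normG T with hgdef
  have hmR : (1 : ℝ) ≤ m := by exact_mod_cast hm1
  have hnR : (1 : ℝ) ≤ n := by exact_mod_cast hn1
  have hlam0 : 0 ≤ lam := by linarith
  have hsqm : 1 ≤ √(m : ℝ) := Real.one_le_sqrt.2 hmR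
  have hsqn : 1 ≤ √(n : ℝ) := Real.one_le_sqrt.2 hnR
  have hsqnn : √(n : ℝ) ≤ √(n + 1 : ℝ) := Real.sqrt_le_sqrt (by linarith)
  set xG := lam * √m * u with hxG
  set xC := lam * √(n + 1) * u with hxC
  set xS := lam * √n * u with hxS
  have huG : u ≤ xG := le_mul_of_one_le_left hu.le (one_le_mul_of_one_le_of_one_le hlam hsqm)
  have huS : u ≤ xS := le_mul_of_one_le_left hu.le (one_le_mul_of_one_le_of_one_le hlam hsqn)
  have hSC : xS ≤ xC := by
    rw [hxS, hxC]
    gcongr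
  have hnG : n * xG ≤ 1 / 2200 := by rw [hxG]; linarith
  have hnC : n * xC ≤ 1 / 2200 := by rw [hxC]; linarith
  have hnS : n * xS ≤ 1 / 2200 := le_trans (by gcongr) hnC
  have hG1 : xG ≤ n * xG := le_mul_of_one_le_left (by linarith) hnR
  have hC1 : xC ≤ n * xC := le_mul_of_one_le_left (by linarith) hnR
  have hS1 : xS ≤ n * xS := le_mul_of_one_le_left (by linarith) hnR
  have hu1 : u ≤ 1 / 2200 := by linarith
  have hu2 : u ≤ 1 / 2 := by linarith
  have hG2 : xG ≤ 1 / 2200 := by linarith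
  have hC2 : xC ≤ 1 / 2200 := by linarith
  have hS2 : xS ≤ 1 / 2200 := by linarith
  have hnu : n * u ≤ n * xC := by gcongr; linarith
  have hKG : m * u ^ 2 ≤ xG / 2200 := by
    have h1 : m * u ≤ 1 / 2200 := by
      have : (m : ℝ) * u ≤ m * u * n := le_mul_of_one_le_right (by positivity) hnR
      linarith
    exact mul_sq_le_div hu.le h1 (by linarith)
  have hKC : (n + 1) * u ^ 2 ≤ xC / 2200 := by
    have h1 : (n + 1) * u ≤ 1 / 2200 := by
      have : (n + 1) * u ≤ n * ((n + 1) * u) := le_mul_of_one_le_left (by positivity) hnR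
      linarith
    exact mul_sq_le_div hu.le h1 (by linarith)
  have hKS : n * u ^ 2 ≤ xS / 2200 := by
    have h1 : n * u ≤ 1 / 2200 := by linarith
    exact mul_sq_le_div hu.le h1 huS
  have hs' : s = 11 * (n * xG + n * xC) * g ^ 2 := by rw [hs, hxG, hxC]; ring
  have hg2 : 0 < g ^ 2 := by positivity
  have hs0 : 0 < s := by
    rw [hs']
    have : 0 < n * xG + n * xC := by linarith
    positivity
  have hsg : s ≤ 0.01 * g ^ 2 := by
    rw [hs']
    gcongr
    linarith
  set A := gramShifted T s ord δ with hA
  set e := (3.01 * xG + 1.02 * u) * g ^ 2 with he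
  have hAe : ∀ j l, |A j l - (∑ r, T r j * T r l + if j = l then s else 0)| ≤ e :=
    hδ.abs_gramShifted_sub_le hlam0 hb hu2 hG2 hKG hs0.le hsg
  have hne : n * e ≤ 3.01 * (n * xG * g ^ 2) + 1.02 * (n * xC * g ^ 2) := by
    have : n * u * g ^ 2 ≤ n * xC * g ^ 2 := by gcongr
    rw [he]
    linarith
  have hGg : 0 ≤ n * xG * g ^ 2 := by have : 0 ≤ xG := by linarith
                                      positivity
  have hCg : 0 < n * xC * g ^ 2 := by have : 0 < xC := by linarith
                                      positivity
  have hquad : ∀ x : Fin n → ℝ, (s - n * e) * ∑ j, x j ^ 2 ≤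
      ∑ j, ∑ l, x j * x l * symmUpper A j l := fun x =>
    le_trans (le_add_of_nonneg_left (sum_nonneg fun _ _ => sq_nonneg _))
      (le_quadForm_symmUpper (fun j l _ => hAe j l) x)
  have hAjj : ∀ j, A j j ≤ (1 - (4 + 1 / 100) * xC) * (1.03 * g ^ 2) := by
    intro j
    have h1 := (abs_le.1 (hAe j j)).2
    rw [if_pos rfl] at h1
    have h2 : ∑ r, T r j * T r j ≤ g ^ 2 := by
      simpa only [sq] using sum_sq_le_normG_sq T j
    have h3 : e ≤ 0.005 * g ^ 2 := by
      rw [he]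
      gcongr
      linarith
    have h4 : xC * g ^ 2 ≤ 1 / 2200 * g ^ 2 := by gcongr
    linarith
  have hrun : ∀ i, 0 < cholPivot A ord δ i :=
    hδ.cholPivot_pos hlam0 hb hu2 hC2 hKC (B := 1.03 * g ^ 2) (by positivity)
      hquad (by rw [hs', ← hxC]; linarith) hAjj
  have hC0 : 0 < 1 - (4 + 1 / 100) * xC := by linarith
  set V := factorV T s ord δ with hVdef
  have htri : ∀ k j, j < k → V k j = 0 := fun k j h => cholRow_eq_zero _ _ _ h
  have hdiag : ∀ j, V j j ≠ 0 := fun j => (cholRow_self_pos hb hu2 (hrun j)).ne'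
  have hcol : ∀ j, ∑ k, V k j ^ 2 ≤ 1.03 * g ^ 2 := by
    intro j
    have h1 := hδ.one_sub_mul_sum_sq_cholRow_le hlam0 hb hu2 hC2 hKC (hrun j)
    exact le_of_mul_le_mul_left (h1.trans (hAjj j)) hC0
  have hVe : ∀ j l, j ≤ l → |A j l - ∑ k, V k j * V k l| ≤ 4.01 * xC * (1.03 * g ^ 2) := by
    intro j l hjl
    have h1 := hδ.abs_sub_sum_cholRow_le hlam0 hb hu2 hC2 hKC hjl (hrun j)
    refine h1.trans ?_
    have h2 : ∑ k, |V k j * V k l| ≤ 1.03 * g ^ 2 := by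
      refine (sum_abs_mul_le _ _).trans ?_
      rw [← Real.mul_self_sqrt (show 0 ≤ 1.03 * g ^ 2 by positivity)]
      gcongr <;> exact hcol _
    have h3 : 0 ≤ xC := by linarith
    rw [← hxC, show (4 + 1 / 100 : ℝ) = 4.01 by norm_num]
    gcongr
    exact h2
  have hV : ∀ x : Fin n → ℝ,
      ∑ r, (T *ᵥ x) r ^ 2 + s / 2 * ∑ j, x j ^ 2 ≤ ∑ k, (V *ᵥ x) k ^ 2 :=
    sum_sq_mulVec_add_le (fun j l _ => hAe j l) hVe (by rw [hs']; linarith)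
  obtain ⟨hres, horth⟩ := sum_sq_residual_le_and_sum_sq_mulVec_le (Q := factorQ T s ord δ) hs0 hg
    (show 0 ≤ xS by linarith) hnS (by
      rw [hs']
      have : n * xS ≤ n * xC := by gcongr
      gcongr
      linarith) hV hcol
    (fun r j => hδ.abs_sub_sum_solveRow_le hlam0 hb hu2 hS2 hKS T htri hdiag r j)
  refine ⟨hrun, norm2_transpose_mul_self_sub_one_le horth, ?_⟩
  have h0 : 0 ≤ xS := by linarith
  exact Real.sqrt_le_iff.2 ⟨by positivity, hres⟩

end SCholQR

/-! ### The probabilistic bound -/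

namespace SCholQR

lemma probQ_le_one {u lam k : ℝ} (hk : 0 ≤ k) : probQ u lam k ≤ 1 := by
  unfold probQ probP
  have : 0 ≤ k * (2 * Real.exp (-(lam ^ 2 * (1 - u) ^ 2) / 2)) := by positivity
  linarith

lemma probQ_le_probP {u lam k : ℝ} (hk : 1 ≤ k) : probQ u lam k ≤ probP u lam := by
  unfold probQ probP
  have : 0 < Real.exp (-(lam ^ 2 * (1 - u) ^ 2) / 2) := Real.exp_pos _
  nlinarith

lemma one_le_of_probP_pos {u lam : ℝ} (hu : 0 ≤ u) (hu1 : u ≤ 1) (hlam : 0 ≤ lam)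
    (h : 0 < probP u lam) : 1 ≤ lam := by
  by_contra! hlt
  have h1 : lam ^ 2 ≤ 1 := pow_le_one₀ hlam hlt.le
  have h2 : (1 - u) ^ 2 ≤ 1 := pow_le_one₀ (by linarith) (by linarith)
  have h3 : lam ^ 2 * (1 - u) ^ 2 ≤ 1 := mul_le_one₀ h1 (sq_nonneg _) h2
  have h4 := Real.add_one_le_exp (-(lam ^ 2 * (1 - u) ^ 2) / 2)
  unfold probP at h
  linarith

end SCholQR

theorem theorem4p1 {m n : ℕ} (T : Matrix (Fin m) (Fin n) ℝ) (hT : T ≠ 0)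
    (u lam : ℝ) (hu : 0 < u) (hlam : 0 < lam)
    (hm : max (lam * √(m : ℝ) * n * u) ((m : ℝ) * n * u) ≤ 1 / 2200)
    (hn : max (lam * √((n : ℝ) + 1) * n * u) ((n : ℝ) * (n + 1) * u) ≤ 1 / 2200)
    (hQ₁ : 0 < SCholQR.probQ u lam ((m : ℝ) * n ^ 2))
    (hQ₂ : 0 < SCholQR.probQ u lam ((n : ℝ) ^ 3 / 6 + (n : ℝ) ^ 2 / 2 + (n : ℝ) / 3))
    (hQ₃ : 0 < SCholQR.probQ u lam ((n : ℝ) * (n + 1) / 2))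
    (s : ℝ)
    (hs : s = 11 * lam * (√(m : ℝ) * n * u + √((n : ℝ) + 1) * n * u) * SCholQR.normG T ^ 2)
    (p₁ : ℝ) (hp₁ : p₁ = SCholQR.normG T / SCholQR.norm2 T)
    (ord : SCholQR.EvalOrder m n)
    {Ω : Type*} [MeasurableSpace Ω] (μ : Measure Ω) [IsProbabilityMeasure μ]
    (δ : SCholQR.Op m n → Ω → ℝ) (hδ : SCholQR.RoundingModel μ u δ)
    (Q : Ω → Matrix (Fin m) (Fin n) ℝ)
    (hQ : ∀ ω, Q ω = SCholQR.factorQ T s ord (fun o => δ o ω))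
    (V : Ω → Matrix (Fin n) (Fin n) ℝ)
    (hV : ∀ ω, V ω = SCholQR.factorV T s ord (fun o => δ o ω)) :
    SCholQR.probQ u lam ((m : ℝ) * n ^ 2)
        * SCholQR.probQ u lam ((n : ℝ) ^ 3 / 6 + (n : ℝ) ^ 2 / 2 + (n : ℝ) / 3)
        * SCholQR.probQ u lam ((n : ℝ) * (n + 1) / 2)
      ≤ μ.real {ω | SCholQR.RunsToCompletion T s ord (fun o => δ o ω) ∧
          SCholQR.norm2 ((Q ω).transpose * Q ω - 1) ≤ 1.6 ∧
          SCholQR.normF (Q ω * V ω - T)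
            ≤ 1.67 * lam * p₁ * (n * √(n : ℝ)) * u * SCholQR.norm2 T} := by
  obtain ⟨i, j, hij⟩ : ∃ i j, T i j ≠ 0 := by
    by_contra! h
    exact hT (Matrix.ext h)
  have hm1 : 1 ≤ m := Nat.one_le_of_lt i.2
  have hn1 : 1 ≤ n := Nat.one_le_of_lt j.2
  have hmR : (1 : ℝ) ≤ m := by exact_mod_cast hm1
  have hnR : (1 : ℝ) ≤ n := by exact_mod_cast hn1
  have hmn : (1 : ℝ) ≤ m * n ^ 2 := one_le_mul_of_one_le_of_one_le hmR (one_le_pow₀ hnR)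
  have hu1 : u ≤ 1 := by
    have h1 : (1 : ℝ) ≤ m * n := one_le_mul_of_one_le_of_one_le hmR hnR
    have h2 := le_mul_of_one_le_left hu.le h1
    linarith [(le_max_right _ _).trans hm]
  have hlam1 := SCholQR.one_le_of_probP_pos hu.le hu1 hlam.le
    (hQ₁.trans_le (SCholQR.probQ_le_probP hmn))
  have hprod : SCholQR.probQ u lam ((m : ℝ) * n ^ 2)
        * SCholQR.probQ u lam ((n : ℝ) ^ 3 / 6 + (n : ℝ) ^ 2 / 2 + (n : ℝ) / 3)
        * SCholQR.probQ u lam ((n : ℝ) * (n + 1) / 2) ≤ SCholQR.probP u lam := by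
    refine le_trans ?_ (SCholQR.probQ_le_probP hmn)
    rw [mul_assoc]
    exact mul_le_of_le_one_right hQ₁.le (mul_le_one₀ (SCholQR.probQ_le_one (by positivity)) hQ₃.le
      (SCholQR.probQ_le_one (by positivity)))
  refine hprod.trans ((hδ.le_measureReal_smallDeviations hu hu1 hlam hm1 hn1 ord hQ₁ hQ₂).trans
    (measureReal_mono fun ω hω => ?_))
  obtain ⟨h1, h2, h3⟩ := SCholQR.SmallDeviations.runsToCompletion_and_le hω hlam1
    (fun o => hδ.bound o ω) hu hT hm1 hn1 ((le_max_left _ _).trans hm) ((le_max_right _ _).trans hm)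
    ((le_max_left _ _).trans hn) ((le_max_right _ _).trans hn) hs
  have hp : p₁ * SCholQR.norm2 T = SCholQR.normG T := by
    rw [hp₁, div_mul_cancel₀ _ (SCholQR.norm2_ne_zero hT)]
  refine ⟨h1, ?_, ?_⟩
  · rw [hQ]
    exact h2.trans (by norm_num)
  · rw [hQ, hV]
    refine h3.trans_eq ?_
    rw [← hp]
    ring
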